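/- Let $\psi=\Gamma'/\Gamma$ be the digamma function. For $\nu,\mu\in\mathbb{C}$ and $z\in\mathbb{C}\setminus(-\infty,1]$ let $$P_\nu^\mu(z)=\left(\frac{z+1}{z-1}\right)^{\mu/2}\frac{1}{\Gamma(1-\mu)}\,{}_2F_1\!\left(-\nu,\nu+1;1-\mu;\frac{1-z}{2}\right)$$ be Hobson's associated Legendre function of the first kind, where $\frac{1}{\Gamma(c)}{}_2F_1(a,b;c;w)$ denotes the analytic continuation to $w\in\mathbb{C}\setminus[1,\infty)$ of $\sum_{k\ge0}\frac{(a)_k(b)_k}{\Gamma(c+k)\,k!}w^k$ (with $1/\Gamma=0$ at the non-positive integers). All logarithms and powers of $z\pm1$ are taken with $-\pi<\arg(z\pm1)<\pi$; in particular $\left(\frac{z+1}{z-1}\right)^{s}=(z+1)^{s}(z-1)^{-s}$ and $\left(\frac{z^2-1}{4}\right)^{s}=\left(\frac{z-1}{2}\right)^{s}\left(\frac{z+1}{2}\right)^{s}$. An empty sum is zero. Then for all integers $0\le m\le n$ and all $z\in\mathbb{C}\setminus(-\infty,1]$, the function $\nu\mapsto P_\nu^m(z)$ is complex differentiable at $\nu=n$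 and $$\begin{aligned} \frac{\partial P_\nu^m(z)}{\partial\nu}\bigg|_{\nu=n} ={}&P_n^m(z)\ln\frac{z+1}{2}+[\psi(n+m+1)-\psi(n-m+1)]P_n^m(z)\\ &-(-1)^n\frac{(n+m)!}{(n-m)!}\left(\frac{z^2-1}{4}\right)^{-m/2}\sum_{k=0}^{m-1}\frac{(k+n-m)!\,(m-k-1)!}{k!\,(n+m-k)!}\left(\frac{z+1}{2}\right)^k\\ &+(-1)^n\frac{(n+m)!}{(n-m)!}\left(\frac{z+1}{z-1}\right)^{m/2}\sum_{k=0}^{n}(-1)^k\frac{(k+n)!}{k!\,(k+m)!\,(n-k)!}\\ &\qquad\times[2\psi(k+n+1)-\psi(k+m+1)-\psi(k+1)]\left(\frac{z+1}{2}\right)^k . \end{aligned}$$ -/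

import Mathlib

noncomputable section

/-- The complex plane cut along the real half-line `[1, ∞)`. -/
def hypergeometricDomain : Set ℂ := {w | 1 - w ∈ Complex.slitPlane}

/-- `F` is a holomorphic continuation to `ℂ \ [1, ∞)` of the regularized Gauss series
`∑ k, (a)_k (b)_k / (Γ (c + k) k!) w ^ k`, which converges in the open unit disc. -/
def IsHypergeometricContinuation (a b c : ℂ) (F : ℂ → ℂ) : Prop :=
  DifferentiableOn ℂ F hypergeometricDomain ∧
    ∀ w ∈ Metric.ball (0 : ℂ) 1, F w = Complex.regularizedGaussHGFun a b c w

open Classical in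
/-- The regularized Gauss hypergeometric function `₂F₁(a, b; c; w) / Γ(c)` on `ℂ \ [1, ∞)`: the
holomorphic continuation of its series (unique there, as the domain is connected). -/
def hypergeometricReg (a b c : ℂ) : ℂ → ℂ :=
  if h : ∃ F : ℂ → ℂ, IsHypergeometricContinuation a b c F then Classical.choose h else 0

/-- Hobson's associated Legendre function of the first kind of degree `ν` and order `μ` on
`ℂ \ (-∞, 1]`:
`P_ν^μ(z) = ((z + 1) / (z - 1)) ^ (μ / 2) * ₂F₁(-ν, ν + 1; 1 - μ; (1 - z) / 2) / Γ(1 - μ)`,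
with the principal phases of `z + 1` and `z - 1`. -/
def legendreP (ν μ z : ℂ) : ℂ :=
  (z + 1) ^ (μ / 2) * (z - 1) ^ (-μ / 2) * hypergeometricReg (-ν) (ν + 1) (1 - μ) ((1 - z) / 2)

end

/-! ### Power series on the unit disc, the cut plane and continuations -/

section TaylorCoefficients

open Complex Filter Topology Metric

/-! Put w = (1 - z)/2, u = 1 - w = (z + 1)/2, and let F(ν, c; w) be the continuation of ₂F₁(-ν, ν +
1; c; w)/Γ(c). The prefactor of the Legendre function does not involve ν, so the task is to
differentiate F(ν, 1 - m; w) in ν at n. Three ideas do this.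

Order lowering: w d/dw + c sends F(ν, c + 1; ·) to F(ν, c; ·). Difference quotients in ν that
converge locally uniformly in w may be differentiated in w, so the operator also carries the
ν-derivative from c + 1 to c (`HasHypergeometricDegreeDeriv.lower`).

Existence: for c = n + 2 Euler's integral converges for all ν near n and gives both the continuation
to the cut plane and its holomorphy in ν (`exists_hasHypergeometricDegreeDeriv`). Lowering n + 1
times reaches c = 1.

Identification: at c = 1 the function solves Legendre's equation, so its ν-derivative H solves an
inhomogeneous Legendre equation, with H(0) = 0 because F(ν, 1; 0) = 1. A solution of the homogeneous
equation holomorphic at 0 and vanishing there is zero, so it suffices that P log u plus the digamma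
polynomial satisfies the same two conditions (`hasHypergeometricDegreeDeriv_one`). Lowering m more
times, where the operator reads (u - 1) d/du - j at order j, produces the general formula
(`legendreDegreeDeriv_order_succ`); the finite sum with negative powers of u collects the poles
created by differentiating log u. -/

/-- `f` is the sum on the open unit disc of the power series with coefficients `a`. -/
def HasTaylorCoeffs (f : ℂ → ℂ) (a : ℕ → ℂ) : Prop :=
  ∀ w ∈ ball (0 : ℂ) 1, HasSum (fun k => a k * w ^ k) (f w)

namespace HasTaylorCoeffs

variable {f g : ℂ → ℂ} {a b : ℕ → ℂ}

theorem add (hf : HasTaylorCoeffs f a) (hg : HasTaylorCoeffs g b) :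
    HasTaylorCoeffs (fun w => f w + g w) (fun k => a k + b k) := fun w hw => by
  simpa only [add_mul] using (hf w hw).add (hg w hw)

theorem sub (hf : HasTaylorCoeffs f a) (hg : HasTaylorCoeffs g b) :
    HasTaylorCoeffs (fun w => f w - g w) (fun k => a k - b k) := fun w hw => by
  simpa only [sub_mul] using (hf w hw).sub (hg w hw)

theorem const_mul (hf : HasTaylorCoeffs f a) (c : ℂ) :
    HasTaylorCoeffs (fun w => c * f w) (fun k => c * a k) := fun w hw => by
  simpa only [mul_assoc] using (hf w hw).mul_left c

theorem congr (hf : HasTaylorCoeffs f a) (h : ∀ w ∈ ball (0 : ℂ) 1, g w = f w) :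
    HasTaylorCoeffs g a := fun w hw => by
  rw [h w hw]; exact hf w hw

theorem self_mul (hf : HasTaylorCoeffs f a) :
    HasTaylorCoeffs (fun w => w * f w) (fun k => if k = 0 then 0 else a (k - 1)) := fun w hw => by
  rw [← hasSum_nat_add_iff' 1]
  convert! (hf w hw).mul_left w using 1
  · funext k
    simp only [Nat.add_eq_zero_iff, one_ne_zero, and_false, if_false, Nat.add_sub_cancel]
    ring
  · simp

theorem eq_zero (hf : HasTaylorCoeffs f a) : f 0 = a 0 := by
  have h := hf 0 (by simp)
  refine h.unique ?_
  convert hasSum_single 0 ?_ using 1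
  · simp
  · intro k hk
    simp [hk]

theorem deriv (hf : HasTaylorCoeffs f a) :
    HasTaylorCoeffs (deriv f) (fun k => (k + 1) * a (k + 1)) := fun w hw => by
  obtain ⟨r, hwr, hr1⟩ := exists_between (mem_ball_zero_iff.1 hw)
  have hr0 : 0 ≤ r := (norm_nonneg w).trans hwr.le
  have hr : (r : ℂ) ∈ ball (0 : ℂ) 1 := by
    simpa [abs_of_nonneg hr0] using hr1
  have hs : Summable fun k => ‖a k * (r : ℂ) ^ k‖ := (hf r hr).summable.norm
  have key := hasSum_deriv_of_summable_norm (F := fun k w => a k * w ^ k) (U := ball 0 r) hs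
    (fun k => by fun_prop) isOpen_ball
    (fun k v hv => by
      rw [norm_mul, norm_mul, norm_pow, norm_pow, Complex.norm_real, Real.norm_of_nonneg hr0]
      have := (mem_ball_zero_iff.1 hv).le
      gcongr) (mem_ball_zero_iff.2 hwr)
  have heq : (fun w => ∑' k, a k * w ^ k) =ᶠ[𝓝 w] f := by
    filter_upwards [isOpen_ball.mem_nhds hw] with v hv using (hf v hv).tsum_eq
  rw [heq.deriv_eq, ← hasSum_nat_add_iff' 1] at key
  convert! key using 1
  · funext k
    simp only [deriv_const_mul_field', deriv_pow_field, Nat.add_sub_cancel]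
    push_cast
    ring
  · simp

/-- Each derivative again vanishes on the disc, and its value at 0 isolates the next coefficient.
This turns differential equations into recurrences. -/
theorem coeff_eq_zero (hf : HasTaylorCoeffs f a) (h0 : ∀ w ∈ ball (0 : ℂ) 1, f w = 0) (k : ℕ) :
    a k = 0 := by
  induction k generalizing f a with
  | zero => rw [← hf.eq_zero, h0 0 (by simp)]
  | succ k ih =>
    have h := ih hf.deriv fun w hw => by
      have : f =ᶠ[𝓝 w] fun _ => 0 := by
        filter_upwards [isOpen_ball.mem_nhds hw] with v hv using h0 v hv
      rw [this.deriv_eq, deriv_const]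
    exact (mul_eq_zero.1 h).resolve_left (by exact_mod_cast Nat.succ_ne_zero k)

end HasTaylorCoeffs

theorem DifferentiableOn.exists_hasTaylorCoeffs {f : ℂ → ℂ} (hf : DifferentiableOn ℂ f (ball 0 1)) :
    ∃ a, HasTaylorCoeffs f a :=
  ⟨fun k => (k.factorial : ℂ)⁻¹ * iteratedDeriv k f 0, fun w hw => by
    convert! hasSum_taylorSeries_on_ball hf hw using 1
    funext k
    simp only [sub_zero, smul_eq_mul]
    ring⟩

/-! ### Geometry of the cut plane and the identity theorem -/

theorem isOpen_hypergeometricDomain : IsOpen hypergeometricDomain :=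
  isOpen_slitPlane.preimage (by fun_prop)

theorem ball_subset_hypergeometricDomain : ball (0 : ℂ) 1 ⊆ hypergeometricDomain := fun w hw => by
  have := Complex.mem_slitPlane_of_norm_lt_one (z := -w) (by simpa using hw)
  simpa [hypergeometricDomain, sub_eq_add_neg] using this

theorem zero_mem_hypergeometricDomain : (0 : ℂ) ∈ hypergeometricDomain :=
  ball_subset_hypergeometricDomain (by simp)

/-- Gives the connectedness needed for unique continuation, and keeps 1 - wt off the cut in Euler's
integral. -/
theorem starConvex_hypergeometricDomain : StarConvex ℝ 0 hypergeometricDomain := by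
  intro w hw s t hs ht hst
  have h1 := starConvex_one_slitPlane (show 1 - w ∈ slitPlane from hw) hs ht hst
  show 1 - _ ∈ slitPlane
  convert h1 using 1
  have : (s : ℂ) = 1 - t := by rw [eq_sub_iff_add_eq]; exact_mod_cast hst
  simp only [real_smul, this]
  ring

theorem isPreconnected_hypergeometricDomain : IsPreconnected hypergeometricDomain :=
  (starConvex_hypergeometricDomain.isPathConnected
    zero_mem_hypergeometricDomain).isConnected.isPreconnected

theorem eqOn_hypergeometricDomain_of_eqOn_ball {f g : ℂ → ℂ}
    (hf : DifferentiableOn ℂ f hypergeometricDomain)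
    (hg : DifferentiableOn ℂ g hypergeometricDomain)
    (h : ∀ w ∈ ball (0 : ℂ) 1, f w = g w) : Set.EqOn f g hypergeometricDomain := by
  refine (hf.analyticOnNhd isOpen_hypergeometricDomain).eqOn_of_preconnected_of_eventuallyEq
    (hg.analyticOnNhd isOpen_hypergeometricDomain) isPreconnected_hypergeometricDomain
    zero_mem_hypergeometricDomain ?_
  filter_upwards [ball_mem_nhds (0 : ℂ) one_pos] with w hw using h w hw

/-- The coefficients of the regularized Gauss series. -/
theorem hasTaylorCoeffs_regularizedGaussHGFun (a b c : ℂ) :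
    HasTaylorCoeffs (regularizedGaussHGFun a b c) (fun k =>
      (ascPochhammer ℂ k).eval a * (ascPochhammer ℂ k).eval b / (k.factorial * Gamma (c + k))) := by
  intro w hw
  have h := (regularizedGaussHGFunSeries a b c).hasSum (x := w) (by
    refine Metric.eball_subset_eball (radius_regularizedGaussHGFunSeries_ge_one a b c) ?_
    rw [← ENNReal.ofReal_one, Metric.eball_ofReal]
    exact hw)
  convert! h using 1
  funext k
  rw [FormalMultilinearSeries.apply_eq_prod_smul_coeff, coeff_regularizedGaussHGFunSeries]
  simp [mul_comm]

/-! ### Continuations of the regularized series and lowering of the parameter -/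

namespace IsHypergeometricContinuation

variable {a b c : ℂ} {F G : ℂ → ℂ}

theorem eqOn (hF : IsHypergeometricContinuation a b c F)
    (hG : IsHypergeometricContinuation a b c G) : Set.EqOn F G hypergeometricDomain :=
  eqOn_hypergeometricDomain_of_eqOn_ball hF.1 hG.1 fun w hw => (hF.2 w hw).trans (hG.2 w hw).symm

theorem hypergeometricReg (hF : IsHypergeometricContinuation a b c F) :
    IsHypergeometricContinuation a b c (hypergeometricReg a b c) := by
  have h : ∃ F, IsHypergeometricContinuation a b c F := ⟨F, hF⟩
  rw [_root_.hypergeometricReg, dif_pos h]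
  exact Classical.choose_spec h

theorem hasTaylorCoeffs (hF : IsHypergeometricContinuation a b c F) :
    HasTaylorCoeffs F (fun k =>
      (ascPochhammer ℂ k).eval a * (ascPochhammer ℂ k).eval b / (k.factorial * Gamma (c + k))) :=
  (hasTaylorCoeffs_regularizedGaussHGFun a b c).congr hF.2

theorem of_hasTaylorCoeffs (hd : DifferentiableOn ℂ F hypergeometricDomain)
    (hF : HasTaylorCoeffs F (fun k =>
      (ascPochhammer ℂ k).eval a * (ascPochhammer ℂ k).eval b / (k.factorial * Gamma (c + k)))) :
    IsHypergeometricContinuation a b c F :=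
  ⟨hd, fun w hw => (hF w hw).unique (hasTaylorCoeffs_regularizedGaussHGFun a b c w hw)⟩

/-- The differential operator `w d/dw + c` lowers the parameter `c + 1` to `c`. -/
theorem lower (hF : IsHypergeometricContinuation a b (c + 1) F) :
    IsHypergeometricContinuation a b c (fun w => w * deriv F w + c * F w) := by
  refine of_hasTaylorCoeffs ?_ ?_
  · exact (differentiableOn_id.mul (hF.1.deriv isOpen_hypergeometricDomain)).add
      (hF.1.const_mul c)
  · have h := hF.hasTaylorCoeffs.deriv.self_mul.add (hF.hasTaylorCoeffs.const_mul c)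
    convert h using 1
    funext k
    -- Valid also at the poles, since `Gamma` takes the value 0 there and its inverse is the entire
    -- function 1/Γ. Non-positive integers c, needed for positive orders, are therefore not
    -- exceptional.
    have hG : 1 / Gamma (c + k) = (c + k) * (1 / Gamma (c + 1 + k)) := by
      rw [one_div, one_div, one_div_Gamma_eq_self_mul_one_div_Gamma_add_one]
      congr 3; ring
    have e : ∀ x y z : ℂ, x / (y * z) = x / y * (1 / z) := fun x y z => by
      rw [div_mul_eq_div_div, mul_one_div]
    rw [e, hG]
    rcases k with _ | k
    · simp
    · rw [if_neg (Nat.succ_ne_zero k), Nat.add_sub_cancel, e]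
      push_cast
      ring

end IsHypergeometricContinuation

end TaylorCoefficients

/-! ### Locally uniform derivatives with respect to the degree -/

section DegreeDerivative

open Complex Filter Topology Metric

/-- `H` is the derivative with respect to `ν` at `n`, locally uniformly on the cut plane, of the
functions `₂F₁(-ν, ν + 1; c; ·) / Γ(c)`. -/
structure HasHypergeometricDegreeDeriv (n c : ℂ) (H : ℂ → ℂ) : Prop where
  eventually_continuation : ∀ᶠ ν in 𝓝 n,
    IsHypergeometricContinuation (-ν) (ν + 1) c (hypergeometricReg (-ν) (ν + 1) c)
  tendsto_slope : TendstoLocallyUniformlyOn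
    (fun ν w => (hypergeometricReg (-ν) (ν + 1) c w - hypergeometricReg (-n) (n + 1) c w) / (ν - n))
    H (𝓝[≠] n) hypergeometricDomain

theorem tendstoLocallyUniformlyOn_const {ι X E : Type*} [TopologicalSpace X] [UniformSpace E]
    (f : X → E) (l : Filter ι) (s : Set X) :
    TendstoLocallyUniformlyOn (fun _ => f) f l s := fun _ hu _ _ =>
  ⟨s, self_mem_nhdsWithin, Eventually.of_forall fun _ _ _ => refl_mem_uniformity hu⟩

theorem TendstoLocallyUniformlyOn.congr_eventually {ι X E : Type*} [TopologicalSpace X]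
    [UniformSpace E] {F G : ι → X → E} {f : X → E} {l : Filter ι} {s : Set X}
    (hF : TendstoLocallyUniformlyOn F f l s) (h : ∀ᶠ i in l, Set.EqOn (F i) (G i) s) :
    TendstoLocallyUniformlyOn G f l s :=
  hF.congr_inseparable (h.mono fun _ hi _ hx => .of_eq (hi hx))

namespace HasHypergeometricDegreeDeriv

variable {n c : ℂ} {H H' : ℂ → ℂ}

/-- Continuations are unique on the cut plane, so any explicit family may stand in for the chosen
`hypergeometricReg`. -/
theorem of_continuation {Φ : ℂ → ℂ → ℂ}
    (hΦ : ∀ᶠ ν in 𝓝 n, IsHypergeometricContinuation (-ν) (ν + 1) c (Φ ν))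
    (hH : TendstoLocallyUniformlyOn (fun ν w => (Φ ν w - Φ n w) / (ν - n))
      H (𝓝[≠] n) hypergeometricDomain) :
    HasHypergeometricDegreeDeriv n c H := by
  refine ⟨hΦ.mono fun ν hν => hν.hypergeometricReg, hH.congr_eventually ?_⟩
  filter_upwards [hΦ.filter_mono nhdsWithin_le_nhds] with ν hν w hw
  show (_ - _) / _ = (_ - _) / _
  rw [hν.eqOn hν.hypergeometricReg hw, hΦ.self_of_nhds.eqOn hΦ.self_of_nhds.hypergeometricReg hw]

theorem continuation (h : HasHypergeometricDegreeDeriv n c H) :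
    IsHypergeometricContinuation (-n) (n + 1) c (hypergeometricReg (-n) (n + 1) c) :=
  h.eventually_continuation.self_of_nhds

theorem congr (h : HasHypergeometricDegreeDeriv n c H)
    (hH : Set.EqOn H H' hypergeometricDomain) : HasHypergeometricDegreeDeriv n c H' :=
  ⟨h.1, h.2.congr_right hH⟩

theorem eventually_differentiableOn_slope (h : HasHypergeometricDegreeDeriv n c H) :
    ∀ᶠ ν in 𝓝[≠] n, DifferentiableOn ℂ (fun w => (hypergeometricReg (-ν) (ν + 1) c w -
      hypergeometricReg (-n) (n + 1) c w) / (ν - n)) hypergeometricDomain := by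
  filter_upwards [h.1.filter_mono nhdsWithin_le_nhds] with ν hν
  exact (hν.1.sub h.continuation.1).div_const _

theorem differentiableOn (h : HasHypergeometricDegreeDeriv n c H) :
    DifferentiableOn ℂ H hypergeometricDomain :=
  h.2.differentiableOn h.eventually_differentiableOn_slope isOpen_hypergeometricDomain

theorem hasDerivAt (h : HasHypergeometricDegreeDeriv n c H) {w : ℂ}
    (hw : w ∈ hypergeometricDomain) :
    HasDerivAt (fun ν => hypergeometricReg (-ν) (ν + 1) c w) (H w) n := by
  rw [hasDerivAt_iff_tendsto_slope]
  refine (h.2.tendsto_at hw).congr fun ν => ?_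
  rw [slope_def_field]

/-- By Weierstrass, locally uniform limits of holomorphic functions may be differentiated; pointwise
differentiability in ν would not allow this exchange. -/
theorem tendsto_slope_deriv (h : HasHypergeometricDegreeDeriv n c H) :
    TendstoLocallyUniformlyOn
      (fun ν w => (deriv (hypergeometricReg (-ν) (ν + 1) c) w -
        deriv (hypergeometricReg (-n) (n + 1) c) w) / (ν - n))
      (deriv H) (𝓝[≠] n) hypergeometricDomain := by
  refine (h.2.deriv h.eventually_differentiableOn_slope
    isOpen_hypergeometricDomain).congr_eventually ?_
  filter_upwards [h.1.filter_mono nhdsWithin_le_nhds] with ν hν w hw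
  have h1 := hν.1.differentiableAt (isOpen_hypergeometricDomain.mem_nhds hw)
  have h2 := h.continuation.1.differentiableAt (isOpen_hypergeometricDomain.mem_nhds hw)
  simp only [Function.comp_apply]
  rw [deriv_div_const, deriv_fun_sub h1 h2]

theorem lower (h : HasHypergeometricDegreeDeriv n (c + 1) H) :
    HasHypergeometricDegreeDeriv n c (fun w => w * deriv H w + c * H w) := by
  refine of_continuation (h.1.mono fun ν hν => hν.lower) ?_
  have hid : ContinuousOn (fun w : ℂ => w) hypergeometricDomain := continuousOn_id
  have key := ((tendstoLocallyUniformlyOn_const (fun w : ℂ => w) (𝓝[≠] n) _).mul₀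
    h.tendsto_slope_deriv hid (h.differentiableOn.deriv isOpen_hypergeometricDomain).continuousOn).add
    ((tendstoLocallyUniformlyOn_const (fun _ : ℂ => c) (𝓝[≠] n) _).mul₀ h.2
      continuousOn_const h.differentiableOn.continuousOn)
  refine key.congr fun ν w _ => ?_
  simp only [Pi.add_apply, Pi.mul_apply]
  ring

theorem hypergeometricReg_lower (h : HasHypergeometricDegreeDeriv n (c + 1) H) {w : ℂ}
    (hw : w ∈ hypergeometricDomain) :
    hypergeometricReg (-n) (n + 1) c w = w * deriv (hypergeometricReg (-n) (n + 1) (c + 1)) w +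
      c * hypergeometricReg (-n) (n + 1) (c + 1) w :=
  (h.lower.continuation.eqOn h.continuation.lower hw)

end HasHypergeometricDegreeDeriv

/-- A family of functions depending holomorphically on a parameter and locally bounded has
locally uniformly convergent difference quotients. -/
theorem tendstoLocallyUniformlyOn_slope_of_locally_bounded {J : ℂ → ℂ → ℂ} {n : ℂ} {r : ℝ}
    (hr : 0 < r) {U : Set ℂ} (hJ : ∀ w ∈ U, DifferentiableOn ℂ (fun ν => J ν w) (ball n r))
    (hb : ∀ w₀ ∈ U, ∃ V ∈ 𝓝[U] w₀, ∃ M : ℝ, ∀ w ∈ V, ∀ ν ∈ ball n r, ‖J ν w‖ ≤ M) :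
    TendstoLocallyUniformlyOn (fun ν w => (J ν w - J n w) / (ν - n))
      (fun w => deriv (fun ν => J ν w) n) (𝓝[≠] n) U := by
  rw [Metric.tendstoLocallyUniformlyOn_iff]
  intro ε hε w₀ hw₀
  obtain ⟨V, hV, M, hM⟩ := hb w₀ hw₀
  refine ⟨V ∩ U, inter_mem hV self_mem_nhdsWithin, ?_⟩
  have hn : n ∈ ball n r := mem_ball_self hr
  have hbd : ∀ w ∈ V ∩ U, ∀ ν ∈ ball n r, ν ≠ n →
      ‖deriv (fun ν => J ν w) n - (J ν w - J n w) / (ν - n)‖ ≤ (4 * M / r ^ 2) * ‖ν - n‖ := by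
    rintro w ⟨hwV, hwU⟩ ν hν hνn
    have hd := (hJ w hwU).differentiableAt (ball_mem_nhds n hr)
    have hM0 : 0 ≤ M := (norm_nonneg _).trans (hM w hwV n hn)
    set D := deriv (fun ν => J ν w) n with hD
    have hDb : ‖D‖ ≤ 2 * M / r := by
      refine norm_deriv_le_div_of_mapsTo_ball (f := fun ν => J ν w) (c := n) (hJ w hwU) ?_ hr
      intro ξ hξ
      rw [mem_closedBall, dist_eq_norm]
      linarith [norm_sub_le (J ξ w) (J n w), hM w hwV n hn, hM w hwV ξ hξ]
    -- Second-order Schwarz lemma for the Taylor remainder, which is o(ν - n). Its bound 4M adds 2M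
    -- for the difference of values and 2M for the linear term, by Cauchy's |D| ≤ 2M/r.
    have key := dist_le_mul_div_pow_of_mapsTo_ball_of_isLittleO
      (f := fun ν => J ν w - J n w - D * (ν - n)) (c := n) (R₁ := r) (R₂ := 4 * M) (n := 1) (z := ν)
      (((hJ w hwU).sub (differentiableOn_const _)).sub (by fun_prop)) ?_ ?_ hν
    · simp only [sub_self, mul_zero, dist_zero_right, Nat.reduceAdd] at key
      rw [dist_eq_norm] at key
      have hne : ν - n ≠ 0 := sub_ne_zero.2 hνn
      have hpos : 0 < ‖ν - n‖ := norm_pos_iff.2 hne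
      have e : D - (J ν w - J n w) / (ν - n) = -((J ν w - J n w - D * (ν - n)) / (ν - n)) := by
        field_simp
        ring
      rw [e, norm_neg, norm_div, div_le_iff₀ hpos]
      refine key.trans_eq ?_
      field_simp
    · intro ξ hξ
      simp only [sub_self, mul_zero, mem_closedBall, dist_zero_right]
      have h1 : ‖D * (ξ - n)‖ ≤ 2 * M := by
        rw [norm_mul]
        have h2 : ‖ξ - n‖ ≤ r := by rw [← dist_eq_norm]; exact (mem_ball.1 hξ).le
        calc ‖D‖ * ‖ξ - n‖ ≤ 2 * M / r * r := by gcongr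
          _ = 2 * M := by field_simp
      linarith [norm_sub_le (J ξ w - J n w) (D * (ξ - n)), norm_sub_le (J ξ w) (J n w),
        hM w hwV n hn, hM w hwV ξ hξ]
    · have := hd.hasDerivAt.isLittleO
      simp only [sub_self, mul_zero, sub_zero, pow_one]
      refine (this.congr_left fun ξ => ?_).norm_right
      simp only [smul_eq_mul, ← hD]
      ring
  have hlim : Tendsto (fun ν : ℂ => (4 * M / r ^ 2) * ‖ν - n‖) (𝓝[≠] n) (𝓝 0) := by
    have : Tendsto (fun ν : ℂ => (4 * M / r ^ 2) * ‖ν - n‖) (𝓝 n) (𝓝 ((4 * M / r ^ 2) * ‖n - n‖)) :=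
      Continuous.tendsto (by fun_prop) n
    rw [sub_self, norm_zero, mul_zero] at this
    exact this.mono_left nhdsWithin_le_nhds
  filter_upwards [hlim.eventually_lt_const hε, self_mem_nhdsWithin,
    nhdsWithin_le_nhds (ball_mem_nhds n hr)] with ν h1 h2 h3 w hw
  rw [dist_eq_norm]
  exact (hbd w hw ν h3 h2).trans_lt h1

end DegreeDerivative

/-! ### Euler's integral at c = n + 2 -/

section EulerIntegral

open Complex Filter Topology Metric MeasureTheory

/-- An integral depending holomorphically on a parameter, with a locally uniform integrable bound on
the integrand, is holomorphic in the parameter. -/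
theorem differentiableOn_integral_of_locally_dominated {α : Type*} [MeasurableSpace α]
    {μ : Measure α} {F : ℂ → α → ℂ} {U : Set ℂ} (hU : IsOpen U)
    (hmeas : ∀ z ∈ U, AEStronglyMeasurable (F z) μ)
    (hd : ∀ᵐ a ∂μ, DifferentiableOn ℂ (fun z => F z a) U)
    (hb : ∀ z₀ ∈ U, ∃ V ∈ 𝓝 z₀, ∃ b : α → ℝ, Integrable b μ ∧ ∀ᵐ a ∂μ, ∀ z ∈ V, ‖F z a‖ ≤ b a) :
    DifferentiableOn ℂ (fun z => ∫ a, F z a ∂μ) U := by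
  intro z₀ hz₀
  obtain ⟨V, hV, b, hbi, hbV⟩ := hb z₀ hz₀
  obtain ⟨ε, hε, hεV⟩ := Metric.mem_nhds_iff.1 (inter_mem hV (hU.mem_nhds hz₀))
  -- As 1/2 + 1/3 < 1, Cauchy's estimate on circles of radius ε/3 turns the majorant b into the
  -- majorant b/(ε/3) of the derivative.
  have hsub : ∀ z ∈ ball z₀ (ε / 2), closedBall z (ε / 3) ⊆ V ∩ U := fun z hz ξ hξ =>
    hεV (by
      rw [mem_ball] at hz ⊢
      rw [mem_closedBall] at hξ
      linarith [dist_triangle ξ z z₀])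
  have h := hasDerivAt_integral_of_dominated_loc_of_deriv_le (F := F) (x₀ := z₀) (μ := μ)
    (F' := fun z a => deriv (fun z => F z a) z) (bound := fun a => b a / (ε / 3))
    (ball_mem_nhds z₀ (half_pos hε)) ?_ ?_ ?_ ?_ (hbi.div_const _) ?_
  · exact h.2.differentiableAt.differentiableWithinAt
  · filter_upwards [hU.mem_nhds hz₀] with z hz using hmeas z hz
  · exact hbi.mono' (hmeas z₀ hz₀) (hbV.mono fun a ha => ha z₀ (mem_of_mem_nhds hV))
  -- The derivative at z₀ is measurable in a as a pointwise limit of difference quotients along a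
  -- sequence tending to z₀.
  · let s : ℕ → ℂ := fun k => z₀ + ((ε / 2 * (1 / ((k : ℝ) + 2)) : ℝ) : ℂ)
    have hpos : ∀ k : ℕ, 0 < ε / 2 * (1 / ((k : ℝ) + 2)) := fun k => by positivity
    have hs0 : Tendsto (fun k : ℕ => ε / 2 * (1 / ((k : ℝ) + 2))) atTop (𝓝 0) := by
      have h1 : Tendsto (fun k : ℕ => 1 / ((k : ℝ) + 2)) atTop (𝓝 0) := by
        simp only [one_div]
        exact tendsto_inv_atTop_zero.comp
          (tendsto_atTop_add_const_right _ _ tendsto_natCast_atTop_atTop)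
      simpa using h1.const_mul (ε / 2)
    have hs : Tendsto s atTop (𝓝[≠] z₀) := by
      refine tendsto_nhdsWithin_iff.2 ⟨?_, Eventually.of_forall fun k => ?_⟩
      · have := (continuous_ofReal.tendsto 0).comp hs0
        simpa [s] using this.const_add z₀
      · simp only [s, Set.mem_compl_iff, Set.mem_singleton_iff, add_eq_left, ofReal_eq_zero]
        exact (hpos k).ne'
    have hsU : ∀ᶠ k in atTop, s k ∈ U :=
      (hs.mono_right nhdsWithin_le_nhds).eventually (hU.mem_nhds hz₀)
    obtain ⟨N, hN⟩ := eventually_atTop.1 hsU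
    refine aestronglyMeasurable_of_tendsto_ae (u := atTop)
      (f := fun k a => slope (fun z => F z a) z₀ (s (k + N))) (fun k => ?_) ?_
    · simp only [slope, vsub_eq_sub, smul_eq_mul]
      exact ((hmeas _ (hN _ (Nat.le_add_left _ _))).sub (hmeas z₀ hz₀)).const_mul _
    · filter_upwards [hd] with a ha
      have := (ha.differentiableAt (hU.mem_nhds hz₀)).hasDerivAt
      rw [hasDerivAt_iff_tendsto_slope] at this
      exact (this.comp hs).comp (tendsto_add_atTop_nat N)
  · filter_upwards [hbV, hd] with a ha hda z hz
    refine norm_deriv_le_of_forall_mem_sphere_norm_le (by positivity) ?_ fun ξ hξ =>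
      ha ξ (hsub z hz (sphere_subset_closedBall hξ)).1
    refine (hda.mono ?_).diffContOnCl
    exact (closure_ball_subset_closedBall.trans (hsub z hz)).trans Set.inter_subset_right
  · filter_upwards [hd] with a hda z hz
    exact (hda.differentiableAt (hU.mem_nhds
      (hsub z hz (mem_closedBall_self (by positivity))).2)).hasDerivAt

/-- The integrand of Euler's integral for `₂F₁(-ν, ν + 1; n + 2; w)`. -/
noncomputable def eulerIntegrand (n : ℕ) (ν w : ℂ) (t : ℝ) : ℂ :=
  (t : ℂ) ^ ν * (1 - t : ℂ) ^ ((n : ℂ) - ν) * (1 - w * t) ^ ν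

/-- Euler's integral for `₂F₁(-ν, ν + 1; n + 2; w)`, without the Gamma factors. -/
noncomputable def eulerIntegral (n : ℕ) (ν w : ℂ) : ℂ :=
  ∫ t in Set.Ioo (0 : ℝ) 1, eulerIntegrand n ν w t

theorem one_sub_mul_mem_slitPlane {w : ℂ} (hw : w ∈ hypergeometricDomain) {t : ℝ}
    (ht : t ∈ Set.Icc (0 : ℝ) 1) : 1 - w * t ∈ slitPlane := by
  have := starConvex_hypergeometricDomain.smul_mem hw ht.1 ht.2
  simpa [hypergeometricDomain, mul_comm] using this

theorem one_sub_ofReal_mem_slitPlane {t : ℝ} (ht : t < 1) : (1 - t : ℂ) ∈ slitPlane := by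
  have : ((1 - t : ℝ) : ℂ) ∈ slitPlane := ofReal_mem_slitPlane.2 (by linarith)
  simpa using this

/-- An integrable majorant on the unit interval. -/
noncomputable def eulerMajorant (t : ℝ) : ℝ := t ^ (-(1 / 2) : ℝ) * (1 - t) ^ (-(1 / 2) : ℝ)

theorem integrable_eulerMajorant :
    Integrable eulerMajorant (volume.restrict (Set.Ioo (0 : ℝ) 1)) := by
  have h := betaIntegral_convergent (u := 1 / 2) (v := 1 / 2) (by norm_num) (by norm_num)
  rw [intervalIntegrable_iff_integrableOn_Ioo_of_le zero_le_one] at h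
  refine h.norm.congr ?_
  filter_upwards [ae_restrict_mem measurableSet_Ioo] with t ht
  have e : (1 - t : ℂ) = ((1 - t : ℝ) : ℂ) := by push_cast; rfl
  rw [norm_mul, e, norm_cpow_eq_rpow_re_of_pos ht.1,
    norm_cpow_eq_rpow_re_of_pos (sub_pos.2 ht.2), eulerMajorant]
  norm_num

/-- For |ν - n| < 1/2 both exponents have real part above -1/2. This is why c = n + 2 is taken: at c
= n + 1 the exponent of 1 - t would be near -1. -/
theorem norm_euler_weight_le {n : ℕ} {ν : ℂ} (hν : ν ∈ ball (n : ℂ) (1 / 2)) {t : ℝ}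
    (ht : t ∈ Set.Ioo (0 : ℝ) 1) :
    ‖(t : ℂ) ^ ν * (1 - t : ℂ) ^ ((n : ℂ) - ν)‖ ≤ eulerMajorant t := by
  have h := (abs_re_le_norm (ν - n)).trans_lt (by rwa [mem_ball, dist_eq_norm] at hν)
  rw [sub_re, natCast_re, abs_lt] at h
  have hn : (0 : ℝ) ≤ n := Nat.cast_nonneg n
  have e : (1 - t : ℂ) = ((1 - t : ℝ) : ℂ) := by push_cast; rfl
  rw [norm_mul, e, norm_cpow_eq_rpow_re_of_pos ht.1,
    norm_cpow_eq_rpow_re_of_pos (sub_pos.2 ht.2), eulerMajorant, sub_re, natCast_re]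
  have h1 : t ^ ν.re ≤ t ^ (-(1 / 2) : ℝ) :=
    Real.rpow_le_rpow_of_exponent_ge ht.1 ht.2.le (by linarith)
  have h2 : (1 - t) ^ ((n : ℝ) - ν.re) ≤ (1 - t) ^ (-(1 / 2) : ℝ) :=
    Real.rpow_le_rpow_of_exponent_ge (sub_pos.2 ht.2) (by linarith [ht.1]) (by linarith)
  exact mul_le_mul h1 h2 (Real.rpow_nonneg (sub_pos.2 ht.2).le _) (Real.rpow_nonneg ht.1.le _)

/-- The factor (1 - wt)^ν is continuous on a compact set of (w, t, ν). The bound is uniform in w and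
ν together, and so serves holomorphy in either variable and local boundedness. -/
theorem exists_bound_eulerIntegrand (n : ℕ) {w₀ : ℂ} (hw₀ : w₀ ∈ hypergeometricDomain) :
    ∃ V ∈ 𝓝 w₀, ∃ M : ℝ, ∀ w ∈ V, ∀ ν ∈ ball (n : ℂ) (1 / 2), ∀ t ∈ Set.Ioo (0 : ℝ) 1,
      ‖eulerIntegrand n ν w t‖ ≤ eulerMajorant t * M := by
  obtain ⟨ε, hε, hεU⟩ := Metric.nhds_basis_closedBall.mem_iff.1
    (isOpen_hypergeometricDomain.mem_nhds hw₀)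
  have hK : IsCompact (closedBall w₀ ε ×ˢ (Set.Icc (0 : ℝ) 1 ×ˢ closedBall (n : ℂ) (1 / 2))) :=
    (isCompact_closedBall _ _).prod (isCompact_Icc.prod (isCompact_closedBall _ _))
  have hc : ContinuousOn (fun p : ℂ × ℝ × ℂ => (1 - p.1 * p.2.1) ^ p.2.2)
      (closedBall w₀ ε ×ˢ (Set.Icc (0 : ℝ) 1 ×ˢ closedBall (n : ℂ) (1 / 2))) := by
    refine ContinuousOn.cpow (by fun_prop) (by fun_prop) fun p hp => ?_
    exact one_sub_mul_mem_slitPlane (hεU hp.1) hp.2.1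
  obtain ⟨M, hM⟩ := hK.exists_bound_of_continuousOn hc
  refine ⟨closedBall w₀ ε, closedBall_mem_nhds w₀ hε, M, fun w hw ν hν t ht => ?_⟩
  have h2 := hM (w, t, ν) ⟨hw, Set.Ioo_subset_Icc_self ht, ball_subset_closedBall hν⟩
  have h1 := norm_euler_weight_le hν ht
  rw [eulerIntegrand, norm_mul]
  exact mul_le_mul h1 h2 (norm_nonneg _) ((norm_nonneg _).trans h1)

theorem continuousOn_euler_weight (n : ℕ) (ν : ℂ) :
    ContinuousOn (fun t : ℝ => (t : ℂ) ^ ν * (1 - t : ℂ) ^ ((n : ℂ) - ν)) (Set.Ioo 0 1) := by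
  refine ContinuousOn.mul ?_ ?_
  · exact ContinuousOn.cpow (by fun_prop) (by fun_prop) fun t ht => ofReal_mem_slitPlane.2 ht.1
  · exact ContinuousOn.cpow (by fun_prop) (by fun_prop) fun t ht =>
      one_sub_ofReal_mem_slitPlane ht.2

theorem aestronglyMeasurable_eulerIntegrand (n : ℕ) (ν : ℂ) {w : ℂ}
    (hw : w ∈ hypergeometricDomain) :
    AEStronglyMeasurable (eulerIntegrand n ν w) (volume.restrict (Set.Ioo (0 : ℝ) 1)) := by
  refine ContinuousOn.aestronglyMeasurable ?_ measurableSet_Ioo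
  refine (continuousOn_euler_weight n ν).mul ?_
  exact ContinuousOn.cpow (by fun_prop) (by fun_prop) fun t ht =>
    one_sub_mul_mem_slitPlane hw (Set.Ioo_subset_Icc_self ht)

theorem differentiableOn_eulerIntegral (n : ℕ) {ν : ℂ} (hν : ν ∈ ball (n : ℂ) (1 / 2)) :
    DifferentiableOn ℂ (eulerIntegral n ν) hypergeometricDomain := by
  refine differentiableOn_integral_of_locally_dominated isOpen_hypergeometricDomain
    (fun w hw => aestronglyMeasurable_eulerIntegrand n ν hw) ?_ fun w₀ hw₀ => ?_
  · filter_upwards [ae_restrict_mem measurableSet_Ioo] with t ht w hw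
    have := one_sub_mul_mem_slitPlane hw (Set.Ioo_subset_Icc_self ht)
    refine DifferentiableAt.differentiableWithinAt ?_
    have hd : DifferentiableAt ℂ (fun w : ℂ => (1 - w * t) ^ ν) w :=
      DifferentiableAt.cpow (by fun_prop) (by fun_prop) this
    exact hd.const_mul _
  · obtain ⟨V, hV, M, hM⟩ := exists_bound_eulerIntegrand n hw₀
    refine ⟨V, hV, _, integrable_eulerMajorant.mul_const M, ?_⟩
    filter_upwards [ae_restrict_mem measurableSet_Ioo] with t ht w hw using hM w hw ν hν t ht

theorem differentiableOn_eulerIntegral_degree (n : ℕ) {w : ℂ} (hw : w ∈ hypergeometricDomain) :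
    DifferentiableOn ℂ (fun ν => eulerIntegral n ν w) (ball (n : ℂ) (1 / 2)) := by
  refine differentiableOn_integral_of_locally_dominated isOpen_ball
    (fun ν _ => aestronglyMeasurable_eulerIntegrand n ν hw) ?_ fun ν₀ hν₀ => ?_
  · filter_upwards [ae_restrict_mem measurableSet_Ioo] with t ht ν _
    have h1 := one_sub_mul_mem_slitPlane hw (Set.Ioo_subset_Icc_self ht)
    have h2 := one_sub_ofReal_mem_slitPlane ht.2
    have h3 : (t : ℂ) ∈ slitPlane := ofReal_mem_slitPlane.2 ht.1
    refine DifferentiableAt.differentiableWithinAt ?_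
    have d1 : DifferentiableAt ℂ (fun ν : ℂ => (1 - w * t) ^ ν) ν :=
      DifferentiableAt.cpow (by fun_prop) (by fun_prop) h1
    have d2 : DifferentiableAt ℂ (fun ν : ℂ => (1 - t : ℂ) ^ ((n : ℂ) - ν)) ν :=
      DifferentiableAt.cpow (by fun_prop) (by fun_prop) h2
    have d3 : DifferentiableAt ℂ (fun ν : ℂ => (t : ℂ) ^ ν) ν :=
      DifferentiableAt.cpow (by fun_prop) (by fun_prop) h3
    exact (d3.mul d2).mul d1
  · obtain ⟨V, hV, M, hM⟩ := exists_bound_eulerIntegrand n hw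
    refine ⟨_, isOpen_ball.mem_nhds hν₀, _, integrable_eulerMajorant.mul_const M, ?_⟩
    filter_upwards [ae_restrict_mem measurableSet_Ioo] with t ht ν hν using
      hM w (mem_of_mem_nhds hV) ν hν t ht

theorem hasTaylorCoeffs_one_sub_cpow (a : ℂ) :
    HasTaylorCoeffs (fun w => (1 - w) ^ a)
      (fun k => (ascPochhammer ℂ k).eval (-a) / k.factorial) := by
  intro w hw
  have h := (one_div_one_sub_cpow_hasFPowerSeriesOnBall_zero (-a)).hasSum (y := w) (by
    rw [← ENNReal.ofReal_one, Metric.eball_ofReal]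
    exact hw)
  convert! h using 1
  · funext k
    rw [FormalMultilinearSeries.apply_eq_prod_smul_coeff]
    have e : Ring.choose (-a + k - 1) k = (ascPochhammer ℂ k).eval (-a) / k.factorial := by
      rw [eq_div_iff (by exact_mod_cast k.factorial_ne_zero), mul_comm, ← nsmul_eq_mul,
        ← Ring.descPochhammer_eq_factorial_smul_choose,
        Polynomial.descPochhammer_smeval_eq_ascPochhammer, Polynomial.ascPochhammer_smeval_eq_eval]
      congr 1
      ring
    simp [e, mul_comm]
  · simp [cpow_neg]

theorem integral_euler_weight_mul_pow {n : ℕ} {ν : ℂ} (hν : ν ∈ ball (n : ℂ) (1 / 2)) (k : ℕ) :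
    ∫ t in Set.Ioo (0 : ℝ) 1, (t : ℂ) ^ ν * (1 - t : ℂ) ^ ((n : ℂ) - ν) * (t : ℂ) ^ k =
      Gamma (ν + 1 + k) * Gamma (n + 1 - ν) / Gamma (n + 2 + k) := by
  have h := (abs_re_le_norm (ν - n)).trans_lt (by rwa [mem_ball, dist_eq_norm] at hν)
  rw [sub_re, natCast_re, abs_lt] at h
  have hn : (0 : ℝ) ≤ n := Nat.cast_nonneg n
  have hk : (0 : ℝ) ≤ k := Nat.cast_nonneg k
  have e := betaIntegral_eq_Gamma_mul_div (ν + 1 + k) (n + 1 - ν)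
    (by simp only [add_re, one_re, natCast_re]; linarith)
    (by simp only [sub_re, add_re, one_re, natCast_re]; linarith)
  rw [show (n : ℂ) + 2 + k = ν + 1 + k + (n + 1 - ν) by ring, ← e, betaIntegral,
    intervalIntegral.integral_of_le zero_le_one, ← integral_Ioc_eq_integral_Ioo]
  refine setIntegral_congr_fun measurableSet_Ioc fun t ht => ?_
  have ht0 : (t : ℂ) ≠ 0 := ofReal_ne_zero.2 ht.1.ne'
  rw [show ν + 1 + k - 1 = ν + k by ring, cpow_add _ _ ht0, cpow_natCast,
    show (n : ℂ) + 1 - ν - 1 = n - ν by ring]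
  ring

/-- Expand (1 - wt)^ν binomially and integrate termwise; each term is a Beta integral. -/
theorem hasTaylorCoeffs_eulerIntegral {n : ℕ} {ν : ℂ} (hν : ν ∈ ball (n : ℂ) (1 / 2)) :
    HasTaylorCoeffs (eulerIntegral n ν) (fun k => (ascPochhammer ℂ k).eval (-ν) / k.factorial *
      (Gamma (ν + 1 + k) * Gamma (n + 1 - ν) / Gamma (n + 2 + k))) := by
  intro w hw
  set c : ℕ → ℂ := fun k => (ascPochhammer ℂ k).eval (-ν) / k.factorial with hc
  have hsum : Summable fun k => ‖c k * w ^ k‖ := (hasTaylorCoeffs_one_sub_cpow ν w hw).summable.norm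
  have key := hasSum_integral_of_dominated_convergence
    (μ := volume.restrict (Set.Ioo (0 : ℝ) 1))
    (F := fun k t => (t : ℂ) ^ ν * (1 - t : ℂ) ^ ((n : ℂ) - ν) * (c k * (w * t) ^ k))
    (f := eulerIntegrand n ν w)
    (fun k t => eulerMajorant t * ‖c k * w ^ k‖) ?_ ?_ ?_ ?_ ?_
  · convert! key using 1
    funext k
    simp only
    rw [← integral_euler_weight_mul_pow hν, ← integral_const_mul, ← integral_mul_const]
    refine integral_congr_ae (Eventually.of_forall fun t => ?_)
    simp only [mul_pow]
    ring
  · intro k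
    refine ContinuousOn.aestronglyMeasurable ?_ measurableSet_Ioo
    exact (continuousOn_euler_weight n ν).mul (by fun_prop)
  · intro k
    filter_upwards [ae_restrict_mem measurableSet_Ioo] with t ht
    have h1 := norm_euler_weight_le hν ht
    rw [norm_mul]
    refine mul_le_mul h1 ?_ (norm_nonneg _) ((norm_nonneg _).trans h1)
    rw [mul_pow, ← mul_assoc, norm_mul]
    refine mul_le_of_le_one_right (norm_nonneg _) ?_
    rw [norm_pow, norm_real, Real.norm_of_nonneg ht.1.le]
    exact pow_le_one₀ ht.1.le ht.2.le
  · exact Eventually.of_forall fun t => hsum.mul_left _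
  · simp only [tsum_mul_left]
    exact integrable_eulerMajorant.mul_const _
  · filter_upwards [ae_restrict_mem measurableSet_Ioo] with t ht
    refine (hasTaylorCoeffs_one_sub_cpow ν (w * t) ?_).mul_left _
    rw [mem_ball_zero_iff, norm_mul, norm_real, Real.norm_of_nonneg ht.1.le]
    exact (mul_le_of_le_one_right (norm_nonneg _) ht.2.le).trans_lt (mem_ball_zero_iff.1 hw)

/-- Euler's integral, as the continuation of `₂F₁(-ν, ν + 1; n + 2; ·) / Γ(n + 2)`. -/
theorem isHypergeometricContinuation_eulerIntegral {n : ℕ} {ν : ℂ}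
    (hν : ν ∈ ball (n : ℂ) (1 / 2)) :
    IsHypergeometricContinuation (-ν) (ν + 1) (n + 2)
      (fun w => (Gamma (ν + 1))⁻¹ * (Gamma (n + 1 - ν))⁻¹ * eulerIntegral n ν w) := by
  refine .of_hasTaylorCoeffs ((differentiableOn_eulerIntegral n hν).const_mul _) ?_
  have h := (hasTaylorCoeffs_eulerIntegral hν).const_mul ((Gamma (ν + 1))⁻¹ * (Gamma (n + 1 - ν))⁻¹)
  have hr := (abs_re_le_norm (ν - n)).trans_lt (by rwa [mem_ball, dist_eq_norm] at hν)
  rw [sub_re, natCast_re, abs_lt] at hr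
  have hn : (0 : ℝ) ≤ n := Nat.cast_nonneg n
  have h1 : 0 < (ν + 1).re := by simp only [add_re, one_re]; linarith
  have h2 : 0 < ((n : ℂ) + 1 - ν).re := by
    simp only [sub_re, add_re, one_re, natCast_re]; linarith
  have g1 := Gamma_ne_zero_of_re_pos h1
  have g2 := Gamma_ne_zero_of_re_pos h2
  convert h using 1
  funext k
  rw [← Gamma_add_nat_div_Gamma_eq (ν + 1) fun j hj => by
    have := congrArg re hj
    simp only [neg_re, natCast_re] at this
    have hj0 : (0 : ℝ) ≤ j := Nat.cast_nonneg j
    linarith]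
  field_simp

/-- Euler's integral times 1/(Γ(ν + 1)Γ(n + 1 - ν)) is holomorphic in ν and locally bounded, which
forces locally uniform convergence of the slopes. -/
theorem exists_hasHypergeometricDegreeDeriv (n : ℕ) :
    ∃ H, HasHypergeometricDegreeDeriv n (n + 2) H := by
  refine ⟨_, .of_continuation
    (Φ := fun ν w => (Gamma (ν + 1))⁻¹ * (Gamma (n + 1 - ν))⁻¹ * eulerIntegral n ν w)
    ?_ (tendstoLocallyUniformlyOn_slope_of_locally_bounded (r := 1 / 2) (by norm_num) ?_ ?_)⟩
  · filter_upwards [ball_mem_nhds (n : ℂ) (by norm_num : (0 : ℝ) < 1 / 2)] with ν hν using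
      isHypergeometricContinuation_eulerIntegral hν
  · intro w hw
    have h1 : Differentiable ℂ fun ν : ℂ => (Gamma (ν + 1))⁻¹ :=
      differentiable_one_div_Gamma.comp (by fun_prop : Differentiable ℂ fun ν : ℂ => ν + 1)
    have h2 : Differentiable ℂ fun ν : ℂ => (Gamma (n + 1 - ν))⁻¹ :=
      differentiable_one_div_Gamma.comp (by fun_prop : Differentiable ℂ fun ν : ℂ => (n : ℂ) + 1 - ν)
    exact (h1.mul h2).differentiableOn.mul (differentiableOn_eulerIntegral_degree n hw)
  · intro w₀ hw₀
    obtain ⟨V, hV, M, hM⟩ := exists_bound_eulerIntegrand n hw₀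
    have hc : Continuous fun ν : ℂ => (Gamma (ν + 1))⁻¹ * (Gamma (n + 1 - ν))⁻¹ :=
      (differentiable_one_div_Gamma.continuous.comp (by fun_prop : Continuous fun ν : ℂ => ν + 1)).mul
      (differentiable_one_div_Gamma.continuous.comp
        (by fun_prop : Continuous fun ν : ℂ => (n : ℂ) + 1 - ν))
    obtain ⟨C, hC⟩ := (isCompact_closedBall (n : ℂ) (1 / 2)).exists_bound_of_continuousOn
      hc.continuousOn
    refine ⟨V, mem_nhdsWithin_of_mem_nhds hV,
      C * ∫ t in Set.Ioo (0 : ℝ) 1, eulerMajorant t * M, fun w hw ν hν => ?_⟩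
    have hC' := hC ν (ball_subset_closedBall hν)
    rw [norm_mul]
    refine mul_le_mul hC' ?_ (norm_nonneg _) ((norm_nonneg _).trans hC')
    refine norm_integral_le_of_norm_le (integrable_eulerMajorant.mul_const M) ?_
    filter_upwards [ae_restrict_mem measurableSet_Ioo] with t ht using hM w hw ν hν t ht

end EulerIntegral

/-! ### Legendre's equation and uniqueness at the singular point -/

section LegendreEquation

open Complex Filter Topology Metric

/-- Only two consecutive coefficients occur, and the factor (k + 1)² never vanishes, so a
holomorphic solution is determined by its value at 0. -/
theorem HasTaylorCoeffs.legendre_operator {f : ℂ → ℂ} {a : ℕ → ℂ} (hf : HasTaylorCoeffs f a)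
    (l : ℂ) : HasTaylorCoeffs (fun w =>
      _root_.deriv (fun v => v * (1 - v) * _root_.deriv f v) w + l * f w)
      (fun k => (k + 1) ^ 2 * a (k + 1) - (k * (k + 1) - l) * a k) := by
  have h1 := hf.deriv.self_mul
  have h2 := (h1.sub h1.self_mul).congr (g := fun v => v * (1 - v) * _root_.deriv f v)
    fun w _ => by ring
  convert h2.deriv.add (hf.const_mul l) using 1
  funext k
  rcases k with _ | k
  · simp
  · simp only [Nat.add_eq_zero_iff, one_ne_zero, and_false, if_false, Nat.add_sub_cancel]
    push_cast
    ring

theorem IsHypergeometricContinuation.legendre_equation {ν : ℂ} {F : ℂ → ℂ}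
    (hF : IsHypergeometricContinuation (-ν) (ν + 1) 1 F) {w : ℂ} (hw : w ∈ ball (0 : ℂ) 1) :
    deriv (fun v => v * (1 - v) * deriv F v) w + ν * (ν + 1) * F w = 0 := by
  refine (hF.hasTaylorCoeffs.legendre_operator (ν * (ν + 1)) w hw).unique ?_
  convert! hasSum_zero using 1
  funext k
  have g1 : Gamma (1 + (k + 1 : ℕ)) = (k + 1) * Gamma (1 + k) := by
    push_cast
    rw [← add_assoc, Gamma_add_one _ (by rw [add_comm]; exact_mod_cast Nat.succ_ne_zero k)]
    ring
  have g0 : Gamma (1 + (k : ℂ)) ≠ 0 := by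
    rw [add_comm, Gamma_nat_eq_factorial]
    exact_mod_cast k.factorial_ne_zero
  have k0 : (k : ℂ) + 1 ≠ 0 := by exact_mod_cast Nat.succ_ne_zero k
  have f0 : (k.factorial : ℂ) ≠ 0 := by exact_mod_cast k.factorial_ne_zero
  simp only
  rw [g1, Nat.factorial_succ, ascPochhammer_succ_eval, ascPochhammer_succ_eval]
  push_cast
  field_simp
  ring

/-- A solution of Legendre's equation which is holomorphic and vanishes at the singular point `0`
is zero. -/
theorem eqOn_zero_of_legendre_equation {D : ℂ → ℂ} {l : ℂ}
    (hD : DifferentiableOn ℂ D hypergeometricDomain) (h0 : D 0 = 0)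
    (h : ∀ w ∈ ball (0 : ℂ) 1, deriv (fun v => v * (1 - v) * deriv D v) w + l * D w = 0) :
    Set.EqOn D 0 hypergeometricDomain := by
  obtain ⟨a, ha⟩ := (hD.mono ball_subset_hypergeometricDomain).exists_hasTaylorCoeffs
  have hrec := (ha.legendre_operator l).coeff_eq_zero h
  have hz : ∀ k, a k = 0 := by
    intro k
    induction k with
    | zero => rw [← ha.eq_zero, h0]
    | succ k ih =>
      have hk := hrec k
      rw [ih, mul_zero, sub_zero] at hk
      exact (mul_eq_zero.1 hk).resolve_left
        (pow_ne_zero 2 (by exact_mod_cast Nat.succ_ne_zero k))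
  refine eqOn_hypergeometricDomain_of_eqOn_ball hD (differentiableOn_const 0) fun w hw => ?_
  refine (ha w hw).unique ?_
  simp only [hz, zero_mul]
  exact hasSum_zero

namespace HasHypergeometricDegreeDeriv

/-- Legendre's equation differentiated in ν: the right-hand side comes from the derivative 2n + 1 of
ν(ν + 1). -/
theorem legendre_equation {n : ℂ} {H : ℂ → ℂ} (h : HasHypergeometricDegreeDeriv n 1 H) {w : ℂ}
    (hw : w ∈ ball (0 : ℂ) 1) :
    deriv (fun v => v * (1 - v) * deriv H v) w + n * (n + 1) * H w =
      -(2 * n + 1) * hypergeometricReg (-n) (n + 1) 1 w := by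
  have hwU := ball_subset_hypergeometricDomain hw
  have hcont : ContinuousOn (fun v : ℂ => v * (1 - v)) hypergeometricDomain := by fun_prop
  have h1 := (tendstoLocallyUniformlyOn_const (fun v : ℂ => v * (1 - v)) (𝓝[≠] n) _).mul₀
    h.tendsto_slope_deriv hcont (h.differentiableOn.deriv isOpen_hypergeometricDomain).continuousOn
  have hd : ∀ {ν : ℂ}, IsHypergeometricContinuation (-ν) (ν + 1) 1
      (hypergeometricReg (-ν) (ν + 1) 1) → DifferentiableOn ℂ
        (fun v => v * (1 - v) * deriv (hypergeometricReg (-ν) (ν + 1) 1) v)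
        hypergeometricDomain := fun hν =>
    (show Differentiable ℂ fun v : ℂ => v * (1 - v) by fun_prop).differentiableOn.mul
      (hν.1.deriv isOpen_hypergeometricDomain)
  have heq : ∀ ν : ℂ, ((fun _ v => v * (1 - v) : ℂ → ℂ → ℂ) * fun ν v =>
      (deriv (hypergeometricReg (-ν) (ν + 1) 1) v -
        deriv (hypergeometricReg (-n) (n + 1) 1) v) / (ν - n)) ν =
      fun v => (v * (1 - v) * deriv (hypergeometricReg (-ν) (ν + 1) 1) v -
        v * (1 - v) * deriv (hypergeometricReg (-n) (n + 1) 1) v) / (ν - n) := fun ν => by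
    funext v
    simp only [Pi.mul_apply]
    ring
  have h2 := (h1.deriv (by
    filter_upwards [h.1.filter_mono nhdsWithin_le_nhds] with ν hν
    rw [heq]
    exact ((hd hν).sub (hd h.continuation)).div_const _)
    isOpen_hypergeometricDomain).tendsto_at hwU
  -- Uses ν(ν + 1)F_ν - n(n + 1)F_n = ν(ν + 1)(F_ν - F_n) + (ν - n)(ν + n + 1)F_n, divided by ν - n.
  have h3 : Tendsto (fun ν => -(ν * (ν + 1)) * ((hypergeometricReg (-ν) (ν + 1) 1 w -
      hypergeometricReg (-n) (n + 1) 1 w) / (ν - n)) -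
      (ν + n + 1) * hypergeometricReg (-n) (n + 1) 1 w) (𝓝[≠] n)
      (𝓝 (-(n * (n + 1)) * H w - (n + n + 1) * hypergeometricReg (-n) (n + 1) 1 w)) := by
    refine Tendsto.sub (Tendsto.mul ?_ (h.2.tendsto_at hwU)) (Tendsto.mul_const _ ?_)
    · exact (Continuous.tendsto (by fun_prop : Continuous fun ν : ℂ => -(ν * (ν + 1))) n).mono_left
        nhdsWithin_le_nhds
    · exact (Continuous.tendsto (by fun_prop : Continuous fun ν : ℂ => ν + n + 1) n).mono_left
        nhdsWithin_le_nhds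
  have h4 := tendsto_nhds_unique (h2.congr' ?_) h3
  · rw [show (deriv fun v => v * (1 - v) * deriv H v) w = _ from h4]
    ring
  · filter_upwards [h.1.filter_mono nhdsWithin_le_nhds, self_mem_nhdsWithin] with ν hν hne
    have hne' : ν - n ≠ 0 := sub_ne_zero.2 hne
    rw [Function.comp_apply, heq, deriv_div_const,
      deriv_fun_sub ((hd hν).differentiableAt (isOpen_hypergeometricDomain.mem_nhds hwU))
        ((hd h.continuation).differentiableAt (isOpen_hypergeometricDomain.mem_nhds hwU)),
      eq_neg_of_add_eq_zero_left (hν.legendre_equation hw),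
      eq_neg_of_add_eq_zero_left (h.continuation.legendre_equation hw)]
    field_simp
    ring

/-- The series at w = 0 equals 1/Γ(1) = 1 for every ν. -/
theorem apply_zero {n : ℂ} {H : ℂ → ℂ} (h : HasHypergeometricDegreeDeriv n 1 H) : H 0 = 0 := by
  have hval : ∀ {ν : ℂ}, IsHypergeometricContinuation (-ν) (ν + 1) 1
      (hypergeometricReg (-ν) (ν + 1) 1) → hypergeometricReg (-ν) (ν + 1) 1 0 = 1 := fun hν => by
    rw [hν.hasTaylorCoeffs.eq_zero]
    simp
  refine tendsto_nhds_unique (h.2.tendsto_at zero_mem_hypergeometricDomain)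
    (tendsto_const_nhds.congr' ?_)
  filter_upwards [h.1.filter_mono nhdsWithin_le_nhds] with ν hν
  rw [hval hν, hval h.continuation, sub_self, zero_div]

end HasHypergeometricDegreeDeriv

theorem exists_hasHypergeometricDegreeDeriv_one (n : ℕ) :
    ∃ H, HasHypergeometricDegreeDeriv n 1 H := by
  have key : ∀ j : ℕ, ∃ H, HasHypergeometricDegreeDeriv n ((n : ℂ) + 2 - j) H := by
    intro j
    induction j with
    | zero => simpa using exists_hasHypergeometricDegreeDeriv n
    | succ j ih =>
      obtain ⟨H, hH⟩ := ih
      rw [show (n : ℂ) + 2 - j = (n + 2 - (j + 1 : ℕ)) + 1 by push_cast; ring] at hH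
      exact ⟨_, hH.lower⟩
  convert key (n + 1) using 3
  push_cast
  ring

end LegendreEquation

/-! ### Coefficient recurrences for the three polynomials -/

section LegendreCoefficients

open Complex Filter Topology Metric Polynomial

/-- The polynomial with coefficients `f 0, …, f (N - 1)`. -/
noncomputable def rangePoly (f : ℕ → ℂ) (N : ℕ) : ℂ[X] := ∑ k ∈ Finset.range N, C (f k) * X ^ k

theorem coeff_rangePoly (f : ℕ → ℂ) (N k : ℕ) :
    (rangePoly f N).coeff k = if k < N then f k else 0 := by
  simp [rangePoly, finsetSum_coeff, coeff_X_pow]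

theorem coeff_rangePoly_of_forall {f : ℕ → ℂ} {N : ℕ} (hf : ∀ k, N ≤ k → f k = 0) (k : ℕ) :
    (rangePoly f N).coeff k = f k := by
  rw [coeff_rangePoly]
  split_ifs with h
  · rfl
  · exact (hf k (not_lt.1 h)).symm

theorem eval_rangePoly (f : ℕ → ℂ) (N : ℕ) (u : ℂ) :
    (rangePoly f N).eval u = ∑ k ∈ Finset.range N, f k * u ^ k := by
  simp [rangePoly, eval_finsetSum]

theorem coeff_X_sub_one_mul_derivative (p : ℂ[X]) (k : ℕ) :
    ((X - 1) * derivative p).coeff k = k * p.coeff k - (k + 1) * p.coeff (k + 1) := by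
  rw [sub_mul, one_mul, coeff_sub, coeff_derivative]
  rcases k with _ | k
  · simp
  · rw [coeff_X_mul, coeff_derivative]
    push_cast
    ring

theorem coeff_legendre_operator (p : ℂ[X]) (k : ℕ) :
    (derivative (X * (1 - X) * derivative p)).coeff k =
      (k + 1) ^ 2 * p.coeff (k + 1) - k * (k + 1) * p.coeff k := by
  have : X * (1 - X) * derivative p = -(X * ((X - 1) * derivative p)) := by ring
  rw [this, coeff_derivative, coeff_neg, coeff_X_mul, coeff_X_sub_one_mul_derivative]
  ring

/-- The coefficients of the associated Legendre function of integral degree `n` and order `m` in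
powers of `(z + 1) / 2`, up to normalization. -/
noncomputable def legendreCoeff (m n k : ℕ) : ℂ :=
  (-1) ^ k * n.choose k * (k + n).factorial / (n.factorial * (k + m).factorial)

theorem legendreCoeff_of_le {m n k : ℕ} (hk : k ≤ n) : legendreCoeff m n k =
    (-1) ^ k * (k + n).factorial / (k.factorial * (k + m).factorial * (n - k).factorial) := by
  have h1 : (n.factorial : ℂ) ≠ 0 := by exact_mod_cast n.factorial_ne_zero
  have h2 : (k.factorial : ℂ) ≠ 0 := by exact_mod_cast k.factorial_ne_zero
  have h3 : ((n - k).factorial : ℂ) ≠ 0 := by exact_mod_cast (n - k).factorial_ne_zero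
  have h4 : ((k + m).factorial : ℂ) ≠ 0 := by exact_mod_cast (k + m).factorial_ne_zero
  have h : (n.choose k : ℂ) * k.factorial * (n - k).factorial = n.factorial := by
    exact_mod_cast Nat.choose_mul_factorial_mul_factorial hk
  rw [legendreCoeff, ← h]
  rw [← h] at h1
  have h5 : (n.choose k : ℂ) ≠ 0 := by exact_mod_cast (Nat.choose_pos hk).ne'
  field_simp

theorem legendreCoeff_of_lt {m n k : ℕ} (hk : n < k) : legendreCoeff m n k = 0 := by
  simp [legendreCoeff, Nat.choose_eq_zero_of_lt hk]

theorem legendreCoeff_zero (m n : ℕ) : legendreCoeff m n 0 = 1 / m.factorial := by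
  have h1 : (n.factorial : ℂ) ≠ 0 := by exact_mod_cast n.factorial_ne_zero
  simp only [legendreCoeff, pow_zero, Nat.choose_zero_right, Nat.cast_one, zero_add]
  field_simp

/-- No bound on k is needed: the binomial coefficient vanishes beyond n, and n - k is a complex
difference. -/
theorem legendreCoeff_succ (m n k : ℕ) :
    (k + 1) * (k + m + 1) * legendreCoeff m n (k + 1) =
      -((n - k) * (n + k + 1)) * legendreCoeff m n k := by
  have h1 : (n.factorial : ℂ) ≠ 0 := by exact_mod_cast n.factorial_ne_zero
  have h2 : ((k + m).factorial : ℂ) ≠ 0 := by exact_mod_cast (k + m).factorial_ne_zero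
  have h3 : ((k : ℂ) + m + 1) ≠ 0 := by exact_mod_cast Nat.succ_ne_zero (k + m)
  have hc : (n.choose (k + 1) : ℂ) * (k + 1) = n.choose k * (n - k) := by
    rcases le_or_gt k n with h | h
    · rw [← Nat.cast_sub h]
      exact_mod_cast Nat.choose_succ_right_eq n k
    · rw [Nat.choose_eq_zero_of_lt h, Nat.choose_eq_zero_of_lt (h.trans (Nat.lt_succ_self k))]
      simp
  rw [legendreCoeff, legendreCoeff, show k + 1 + n = (k + n) + 1 by ring,
    show k + 1 + m = (k + m) + 1 by ring, Nat.factorial_succ, Nat.factorial_succ, pow_succ]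
  push_cast
  field_simp
  linear_combination (-1 : ℂ) * (k + n + 1) * (k + n).factorial * hc

theorem legendreCoeff_order_succ (m n k : ℕ) :
    legendreCoeff m n k = (k + m + 1) * legendreCoeff (m + 1) n k := by
  have h1 : (n.factorial : ℂ) ≠ 0 := by exact_mod_cast n.factorial_ne_zero
  have h2 : ((k + m).factorial : ℂ) ≠ 0 := by exact_mod_cast (k + m).factorial_ne_zero
  have h3 : ((k : ℂ) + m + 1) ≠ 0 := by exact_mod_cast Nat.succ_ne_zero (k + m)
  rw [legendreCoeff, legendreCoeff, ← add_assoc k m 1, Nat.factorial_succ]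
  push_cast
  field_simp

theorem digamma_natCast_succ (k : ℕ) :
    digamma ((k : ℂ) + 1 + 1) = digamma ((k : ℂ) + 1) + 1 / (k + 1) := by
  rw [digamma_apply_add_one, one_div]
  intro j hj
  have : ((k + 1 + j : ℕ) : ℂ) = 0 := by push_cast; linear_combination hj
  exact absurd (Nat.cast_eq_zero.1 this) (by lia)

/-- The digamma factor in the derivative of the Legendre function. -/
noncomputable def legendreDigamma (m n k : ℕ) : ℂ :=
  2 * digamma ((k : ℂ) + n + 1) - digamma ((k : ℂ) + m + 1) - digamma ((k : ℂ) + 1)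

theorem legendreDigamma_succ (m n k : ℕ) : legendreDigamma m n (k + 1) =
    legendreDigamma m n k + 2 / (k + n + 1) - 1 / (k + m + 1) - 1 / (k + 1) := by
  have h1 := digamma_natCast_succ (k + n)
  have h2 := digamma_natCast_succ (k + m)
  have h3 := digamma_natCast_succ k
  push_cast at h1 h2
  rw [legendreDigamma, legendreDigamma]
  push_cast
  rw [show (k : ℂ) + 1 + n + 1 = k + n + 1 + 1 by ring,
    show (k : ℂ) + 1 + m + 1 = k + m + 1 + 1 by ring, h1, h2, h3]
  ring

theorem legendreDigamma_order_succ (m n k : ℕ) : legendreDigamma (m + 1) n k =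
    legendreDigamma m n k - 1 / (k + m + 1) := by
  have h2 := digamma_natCast_succ (k + m)
  push_cast at h2
  rw [legendreDigamma, legendreDigamma]
  push_cast
  rw [show (k : ℂ) + (m + 1) + 1 = k + m + 1 + 1 by ring, h2]
  ring

/-- The Legendre function of integral degree, up to normalization, in the variable
`(z + 1) / 2`. -/
noncomputable def legendrePoly (m n : ℕ) : ℂ[X] := rangePoly (legendreCoeff m n) (n + 1)

/-- The digamma sum in the derivative of the Legendre function. -/
noncomputable def legendreDigammaPoly (m n : ℕ) : ℂ[X] :=
  rangePoly (fun k => legendreCoeff m n k * legendreDigamma m n k) (n + 1)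

theorem coeff_legendrePoly (m n k : ℕ) : (legendrePoly m n).coeff k = legendreCoeff m n k :=
  coeff_rangePoly_of_forall (fun _ hk => legendreCoeff_of_lt hk) k

theorem coeff_legendreDigammaPoly (m n k : ℕ) : (legendreDigammaPoly m n).coeff k =
    legendreCoeff m n k * legendreDigamma m n k :=
  coeff_rangePoly_of_forall (fun _ hk => by rw [legendreCoeff_of_lt hk, zero_mul]) k

/-- The lowering operator in the variable u: with w = 1 - u, w d/dw - m becomes (u - 1) d/du - m. -/
theorem legendrePoly_order_succ (m n : ℕ) :
    (X - 1) * derivative (legendrePoly m n) - C (m : ℂ) * legendrePoly m n =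
      C (((n : ℂ) - m) * (n + m + 1)) * legendrePoly (m + 1) n := by
  ext k
  have h3 : ((k : ℂ) + m + 1) ≠ 0 := by exact_mod_cast Nat.succ_ne_zero (k + m)
  have h1 := legendreCoeff_succ m n k
  have h2 := legendreCoeff_order_succ m n k
  rw [coeff_sub, coeff_X_sub_one_mul_derivative, coeff_C_mul, coeff_C_mul]
  simp only [coeff_legendrePoly]
  refine mul_left_cancel₀ h3 ?_
  linear_combination -h1 + ((n : ℂ) - m) * (n + m + 1) * h2

/-- The first two terms are the polynomial part of (u - 1)P/u, left by differentiating log u. The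
term with 2n + 1 absorbs the change of ψ(n + m + 1) - ψ(n - m + 1) when m increases. -/
theorem legendreDigammaPoly_order_succ (m n : ℕ) :
    legendrePoly m n - divX (legendrePoly m n) +
      ((X - 1) * derivative (legendreDigammaPoly m n) - C (m : ℂ) * legendreDigammaPoly m n) =
    C (2 * (n : ℂ) + 1) * legendrePoly (m + 1) n +
      C (((n : ℂ) - m) * (n + m + 1)) * legendreDigammaPoly (m + 1) n := by
  ext k
  have h3 : ((k : ℂ) + m + 1) ≠ 0 := by exact_mod_cast Nat.succ_ne_zero (k + m)
  have h4 : ((k : ℂ) + 1) ≠ 0 := by exact_mod_cast Nat.succ_ne_zero k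
  have h5 : ((k : ℂ) + n + 1) ≠ 0 := by exact_mod_cast Nat.succ_ne_zero (k + n)
  have h1 := legendreCoeff_succ m n k
  have h2 := legendreCoeff_order_succ m n k
  simp only [coeff_add, coeff_sub, coeff_X_sub_one_mul_derivative, coeff_C_mul,
    coeff_legendrePoly, coeff_legendreDigammaPoly, coeff_divX, legendreDigamma_succ,
    legendreDigamma_order_succ]
  have h1' : legendreCoeff m n (k + 1) =
      -((n - k) * (n + k + 1)) * legendreCoeff (m + 1) n k / (k + 1) := by
    rw [eq_div_iff h4]
    refine mul_left_cancel₀ h3 ?_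
    linear_combination h1 - (n - k) * (n + k + 1) * h2
  rw [h1', h2]
  field_simp
  ring

theorem legendre_equation_legendrePoly (n : ℕ) :
    derivative (X * (1 - X) * derivative (legendrePoly 0 n)) +
      C ((n : ℂ) * (n + 1)) * legendrePoly 0 n = 0 := by
  ext k
  have h1 := legendreCoeff_succ 0 n k
  rw [coeff_add, coeff_legendre_operator, coeff_C_mul, coeff_zero]
  simp only [coeff_legendrePoly]
  push_cast at h1
  linear_combination h1

/-- The terms -2(u - 1)P' - P are what the Legendre operator leaves from P log u besides the
multiple of log u. -/
theorem legendre_equation_legendreDigammaPoly (n : ℕ) :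
    derivative (X * (1 - X) * derivative (legendreDigammaPoly 0 n)) +
      C ((n : ℂ) * (n + 1)) * legendreDigammaPoly 0 n -
      2 * ((X - 1) * derivative (legendrePoly 0 n)) - legendrePoly 0 n =
    -(C (2 * (n : ℂ) + 1) * legendrePoly 0 n) := by
  ext k
  have h4 : ((k : ℂ) + 1) ≠ 0 := by exact_mod_cast Nat.succ_ne_zero k
  have h5 : ((k : ℂ) + n + 1) ≠ 0 := by exact_mod_cast Nat.succ_ne_zero (k + n)
  have h1 := legendreCoeff_succ 0 n k
  push_cast at h1
  have h1' : legendreCoeff 0 n (k + 1) =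
      -((n - k) * (n + k + 1)) * legendreCoeff 0 n k / (k + 1) ^ 2 := by
    rw [eq_div_iff (pow_ne_zero 2 h4)]
    linear_combination h1
  have h2 : (2 : ℂ[X]) = C 2 := (map_ofNat C 2).symm
  simp only [h2, coeff_add, coeff_sub, coeff_neg, coeff_X_sub_one_mul_derivative,
    coeff_legendre_operator, coeff_C_mul, coeff_legendrePoly, coeff_legendreDigammaPoly,
    legendreDigamma_succ, h1']
  push_cast
  field_simp
  ring

/-- The coefficients of the finite sum with negative powers in the derivative of the Legendre
function. -/
noncomputable def legendreTailCoeff (m n k : ℕ) : ℂ :=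
  (k + n - m).factorial * (m - k - 1).factorial / (k.factorial * (n + m - k).factorial)

/-- The finite sum in the derivative of the Legendre function. -/
noncomputable def legendreTailPoly (m n : ℕ) : ℂ[X] := rangePoly (legendreTailCoeff m n) m

theorem legendreTailCoeff_order_succ_zero {m n : ℕ} (hmn : m < n) (hm : 0 < m) :
    m * legendreTailCoeff m n 0 =
      ((n : ℂ) - m) * (n + m + 1) * legendreTailCoeff (m + 1) n 0 := by
  obtain ⟨d, rfl⟩ := Nat.exists_eq_add_of_lt hmn
  obtain ⟨m, rfl⟩ := Nat.exists_eq_add_of_lt hm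
  simp only [legendreTailCoeff, Nat.factorial_zero, Nat.cast_one, Nat.sub_zero, zero_add, one_mul]
  rw [show m + 1 + d + 1 - (m + 1) = d + 1 by lia, show m + 1 - 1 = m by lia,
    show m + 1 + d + 1 - (m + 1 + 1) = d by lia, show m + 1 + 1 - 1 = m + 1 by lia,
    show m + 1 + d + 1 + (m + 1 + 1) = (m + 1 + d + 1 + (m + 1)) + 1 by lia,
    Nat.factorial_succ d, Nat.factorial_succ m, Nat.factorial_succ (m + 1 + d + 1 + (m + 1))]
  have h1 : ((m + 1 + d + 1 + (m + 1)).factorial : ℂ) ≠ 0 := by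
    exact_mod_cast Nat.factorial_ne_zero _
  have h2 : (((m + 1 + d + 1 + (m + 1) : ℕ) : ℂ) + 1) ≠ 0 := Nat.cast_add_one_ne_zero _
  push_cast at h2 ⊢
  field_simp
  ring

theorem legendreTailCoeff_order_succ_succ {m n k : ℕ} (hmn : m < n) (hk : k + 1 < m) :
    ((k : ℂ) - 2 * m) * legendreTailCoeff m n k + (m - k - 1) * legendreTailCoeff m n (k + 1) =
      ((n : ℂ) - m) * (n + m + 1) * legendreTailCoeff (m + 1) n (k + 1) := by
  obtain ⟨d, rfl⟩ := Nat.exists_eq_add_of_lt hmn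
  obtain ⟨j, rfl⟩ := Nat.exists_eq_add_of_lt hk
  simp only [legendreTailCoeff]
  set N := k + 1 + j + 1 + d + 1 + (k + 1 + j + 1) - (k + 1) with hN
  rw [show k + (k + 1 + j + 1 + d + 1) - (k + 1 + j + 1) = k + d + 1 by lia,
    show k + 1 + j + 1 - k - 1 = j + 1 by lia,
    show k + 1 + j + 1 + d + 1 + (k + 1 + j + 1) - k = N + 1 by lia,
    show k + 1 + (k + 1 + j + 1 + d + 1) - (k + 1 + j + 1) = k + d + 1 + 1 by lia,
    show k + 1 + j + 1 - (k + 1) - 1 = j by lia,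
    show k + 1 + (k + 1 + j + 1 + d + 1) - (k + 1 + j + 1 + 1) = k + d + 1 by lia,
    show k + 1 + j + 1 + 1 - (k + 1) - 1 = j + 1 by lia,
    show k + 1 + j + 1 + d + 1 + (k + 1 + j + 1 + 1) - (k + 1) = N + 1 by lia,
    Nat.factorial_succ N, Nat.factorial_succ j, Nat.factorial_succ k,
    Nat.factorial_succ (k + d + 1)]
  have hN' : (N : ℂ) = k + 2 * j + d + 4 := by
    rw [show N = k + 2 * j + d + 4 by lia]; push_cast; ring
  have h1 : (N.factorial : ℂ) ≠ 0 := by exact_mod_cast Nat.factorial_ne_zero _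
  have h2 : ((N : ℂ) + 1) ≠ 0 := Nat.cast_add_one_ne_zero N
  have h3 : ((k : ℂ) + 1) ≠ 0 := Nat.cast_add_one_ne_zero k
  have h4 : (k.factorial : ℂ) ≠ 0 := by exact_mod_cast Nat.factorial_ne_zero _
  push_cast
  rw [hN'] at h2 ⊢
  field_simp
  ring

theorem legendreTailCoeff_order_succ_last {m n : ℕ} (hmn : m + 1 < n) :
    -((m : ℂ) + 2) * legendreTailCoeff (m + 1) n m + 1 / (m + 1).factorial =
      ((n : ℂ) - (m + 1)) * (n + m + 2) * legendreTailCoeff (m + 2) n (m + 1) := by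
  obtain ⟨d, rfl⟩ := Nat.exists_eq_add_of_lt hmn
  simp only [legendreTailCoeff]
  rw [show m + (m + 1 + d + 1) - (m + 1) = m + d + 1 by lia, show m + 1 - m - 1 = 0 by lia,
    show m + 1 + d + 1 + (m + 1) - m = m + d + 1 + 1 + 1 by lia,
    show m + 1 + (m + 1 + d + 1) - (m + 2) = m + d + 1 by lia,
    show m + 2 - (m + 1) - 1 = 0 by lia,
    show m + 1 + d + 1 + (m + 2) - (m + 1) = m + d + 1 + 1 + 1 by lia,
    Nat.factorial_succ (m + d + 1 + 1), Nat.factorial_succ (m + d + 1), Nat.factorial_succ m]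
  have h1 : ((m + d + 1).factorial : ℂ) ≠ 0 := by exact_mod_cast Nat.factorial_ne_zero _
  have h2 : ((m : ℂ) + d + 1 + 1) ≠ 0 := by exact_mod_cast Nat.succ_ne_zero (m + d + 1)
  have h5 : ((m : ℂ) + d + 1 + 1 + 1) ≠ 0 := by
    exact_mod_cast Nat.succ_ne_zero (m + d + 1 + 1)
  have h3 : ((m : ℂ) + 1) ≠ 0 := Nat.cast_add_one_ne_zero m
  have h4 : (m.factorial : ℂ) ≠ 0 := by exact_mod_cast Nat.factorial_ne_zero _
  push_cast
  field_simp
  ring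

/-- The empty sum at m = 0 acquires its first term solely from the pole of P/u, whose residue is 1
at m = 0. -/
theorem legendreTailCoeff_one_zero {n : ℕ} (hn : 0 < n) :
    1 = (n : ℂ) * (n + 1) * legendreTailCoeff 1 n 0 := by
  obtain ⟨d, rfl⟩ := Nat.exists_eq_add_of_lt hn
  simp only [legendreTailCoeff]
  rw [show 0 + (0 + d + 1) - 1 = d by lia, show 1 - 0 - 1 = 0 by lia,
    show 0 + d + 1 + 1 - 0 = d + 1 + 1 by lia, Nat.factorial_succ (d + 1), Nat.factorial_succ d]
  have h1 : (d.factorial : ℂ) ≠ 0 := by exact_mod_cast Nat.factorial_ne_zero _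
  have h2 : ((d : ℂ) + 1 + 1) ≠ 0 := by exact_mod_cast Nat.succ_ne_zero (d + 1)
  have h3 : ((d : ℂ) + 1) ≠ 0 := by exact_mod_cast Nat.succ_ne_zero d
  push_cast
  simp only [zero_add]
  field_simp

/-- The operator (u - 1) d/du - m applied to T/u^m, plus the polar part of P/u, all multiplied by
u^(m + 1). -/
theorem legendreTailPoly_order_succ {m n : ℕ} (hmn : m < n) :
    (X - 1) * (X * derivative (legendreTailPoly m n) - C (m : ℂ) * legendreTailPoly m n) -
      C (m : ℂ) * (X * legendreTailPoly m n) + C (legendreCoeff m n 0) * X ^ m =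
    C (((n : ℂ) - m) * (n + m + 1)) * legendreTailPoly (m + 1) n := by
  have e : (X - 1) * (X * derivative (legendreTailPoly m n) - C (m : ℂ) * legendreTailPoly m n) -
      C (m : ℂ) * (X * legendreTailPoly m n) + C (legendreCoeff m n 0) * X ^ m =
      X * ((X - 1) * derivative (legendreTailPoly m n)) -
      2 * C (m : ℂ) * (X * legendreTailPoly m n) + C (m : ℂ) * legendreTailPoly m n +
      C (legendreCoeff m n 0) * X ^ m := by ring
  rw [e, legendreCoeff_zero]
  have h2 : (2 : ℂ[X]) = C 2 := (map_ofNat C 2).symm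
  ext k
  simp only [h2, ← C_mul, coeff_add, coeff_sub, coeff_C_mul, coeff_X_pow]
  rcases k with _ | k
  · rw [mul_coeff_zero, mul_coeff_zero, coeff_X_zero]
    simp only [legendreTailPoly, coeff_rangePoly]
    rcases m.eq_zero_or_pos with rfl | hm
    · simpa using legendreTailCoeff_one_zero hmn
    · simpa [hm, hm.ne] using legendreTailCoeff_order_succ_zero hmn hm
  · simp only [coeff_X_mul, coeff_X_sub_one_mul_derivative, legendreTailPoly, coeff_rangePoly]
    -- Interior coefficients; the top one, where the pole of P/u enters; and those beyond, all zero.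
    rcases lt_trichotomy (k + 1) m with h | h | h
    · simp only [if_pos h, if_pos (show k < m by lia), if_neg h.ne,
        if_pos (show k + 1 < m + 1 by lia)]
      have := legendreTailCoeff_order_succ_succ hmn h
      linear_combination this
    · subst h
      simp only [lt_irrefl, if_false, if_true, if_pos (Nat.lt_succ_self k),
        if_pos (Nat.lt_succ_self (k + 1))]
      have := legendreTailCoeff_order_succ_last hmn
      push_cast
      linear_combination this
    · simp only [if_neg h.not_gt, if_neg h.ne', if_neg (show ¬k < m by lia),
        if_neg (show ¬k + 1 < m + 1 by lia)]
      ring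

end LegendreCoefficients

/-! ### Value at u = 1, order recurrence, and the case of integral degree -/

section OrderRecurrence

open Complex Filter Topology Metric Polynomial

/-- Logarithmic derivative of (x + 1)_n = Γ(x + n + 1)/Γ(x + 1) at x = k. -/
theorem digamma_sub_digamma_eq_derivative_ascPochhammer (n k : ℕ) :
    (derivative ((ascPochhammer ℂ n).comp (X + 1))).eval (k : ℂ) =
      ((ascPochhammer ℂ n).comp (X + 1)).eval (k : ℂ) *
        (digamma ((k : ℂ) + n + 1) - digamma ((k : ℂ) + 1)) := by
  induction n with
  | zero => simp
  | succ n ih =>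
    have h1 := digamma_natCast_succ (k + n)
    push_cast at h1
    have h5 : ((k : ℂ) + n + 1) ≠ 0 := by exact_mod_cast Nat.succ_ne_zero (k + n)
    have e : (ascPochhammer ℂ (n + 1)).comp (X + 1) =
        (ascPochhammer ℂ n).comp (X + 1) * (X + 1 + (n : ℂ[X])) := by
      rw [ascPochhammer_succ_right, mul_comp, add_comp, X_comp, natCast_comp]
    rw [e, derivative_mul, eval_add, eval_mul, ih]
    simp only [derivative_add, derivative_X, derivative_one, derivative_natCast, eval_mul, eval_add,
      eval_X, eval_one, eval_natCast, add_zero]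
    push_cast
    rw [show (k : ℂ) + (n + 1) + 1 = k + n + 1 + 1 by ring, h1]
    field_simp
    ring

theorem eval_ascPochhammer_comp_X_add_one (n k : ℕ) :
    ((ascPochhammer ℂ n).comp (X + 1)).eval (k : ℂ) * k.factorial = (k + n).factorial := by
  rw [eval_comp, eval_add, eval_X, eval_one]
  have h := Nat.factorial_mul_ascFactorial k n
  rw [← ascPochhammer_nat_eq_ascFactorial] at h
  have h2 : ((ascPochhammer ℂ n).eval ((k + 1 : ℕ) : ℂ)) = ((ascPochhammer ℕ n).eval (k + 1) : ℕ) :=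
    (ascPochhammer_eval_cast ℂ n (k + 1)).symm
  push_cast at h2
  rw [h2, mul_comm]
  exact_mod_cast h

/-- With p(x) = (x + 1)_n, the sum is a multiple of ∑ (-1)^(n - k) C(n, k) p'(k), the n-th finite
difference at 0 of a polynomial of degree below n. -/
theorem eval_one_legendreDigammaPoly (n : ℕ) : (legendreDigammaPoly 0 n).eval 1 = 0 := by
  rw [legendreDigammaPoly, eval_rangePoly]
  -- For n = 0 the degree bound fails; there 2ψ(1) - ψ(1) - ψ(1) = 0 directly.
  rcases n.eq_zero_or_pos with rfl | hn
  · simp [legendreDigamma, two_mul]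
  set p := (ascPochhammer ℂ n).comp (X + 1) with hp
  have hdeg : (derivative p).natDegree < n := by
    have h1 : p.natDegree = n := by
      rw [hp, natDegree_comp, ascPochhammer_natDegree, show (X + 1 : ℂ[X]) = X + C 1 by simp,
        natDegree_X_add_C, mul_one]
    have := natDegree_derivative_lt (p := p) (by lia)
    lia
  have h := congrFun (fwdDiff_iter_eq_zero_of_degree_lt hdeg) 0
  rw [fwdDiff_iter_eq_sum_shift] at h
  have hf : (n.factorial : ℂ) ≠ 0 := by exact_mod_cast n.factorial_ne_zero
  have key : ∀ k ∈ Finset.range (n + 1), legendreCoeff 0 n k * legendreDigamma 0 n k * 1 ^ k =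
      2 * (-1) ^ n / n.factorial *
        (((-1 : ℤ) ^ (n - k) * (n.choose k : ℤ)) • (derivative p).eval (0 + k • (1 : ℂ))) := by
    intro k hk
    have hkn : k ≤ n := Nat.lt_succ_iff.1 (Finset.mem_range.1 hk)
    have hfk : (k.factorial : ℂ) ≠ 0 := by exact_mod_cast k.factorial_ne_zero
    have hs : (-1 : ℂ) ^ n * (-1) ^ (n - k) = (-1) ^ k := by
      obtain ⟨d, rfl⟩ := Nat.exists_eq_add_of_le hkn
      rw [Nat.add_sub_cancel_left, pow_add, mul_assoc, ← mul_pow]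
      simp
    rw [zero_add, nsmul_eq_mul, mul_one, digamma_sub_digamma_eq_derivative_ascPochhammer, ← hp,
      legendreCoeff, legendreDigamma, ← eval_ascPochhammer_comp_X_add_one, ← hp, zsmul_eq_mul]
    push_cast
    rw [← hs]
    simp only [add_zero, one_pow, mul_one]
    field_simp
    ring
  rw [Finset.sum_congr rfl key, ← Finset.mul_sum, h]
  simp

/-- The normalization of the Legendre function. -/
noncomputable def legendreScale (m n : ℕ) : ℂ :=
  (-1) ^ n * ((n + m).factorial / (n - m).factorial)

theorem legendreScale_order_succ {m n : ℕ} (hmn : m < n) :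
    legendreScale (m + 1) n = legendreScale m n * (((n : ℂ) - m) * (n + m + 1)) := by
  obtain ⟨d, rfl⟩ := Nat.exists_eq_add_of_lt hmn
  simp only [legendreScale]
  rw [show m + d + 1 - (m + 1) = d by lia, show m + d + 1 - m = d + 1 by lia, ← add_assoc,
    Nat.factorial_succ (m + d + 1 + m), Nat.factorial_succ d]
  have h1 : (d.factorial : ℂ) ≠ 0 := by exact_mod_cast Nat.factorial_ne_zero _
  have h2 : (d : ℂ) + 1 ≠ 0 := Nat.cast_add_one_ne_zero d
  push_cast
  field_simp
  ring

/-- The degree derivative of the Legendre function of integral degree, up to the elementary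
prefactor, in the variable `u = (z + 1) / 2`. -/
noncomputable def legendreDegreeDeriv (m n : ℕ) (u : ℂ) : ℂ :=
  legendreScale m n * ((legendrePoly m n).eval u * log u +
    (digamma ((n : ℂ) + m + 1) - digamma ((n : ℂ) - m + 1)) * (legendrePoly m n).eval u +
    (legendreDigammaPoly m n).eval u - (legendreTailPoly m n).eval u / u ^ m)

theorem hasDerivAt_legendreDegreeDeriv (m n : ℕ) {u : ℂ} (hu : u ∈ slitPlane) :
    HasDerivAt (legendreDegreeDeriv m n)
      (legendreScale m n * ((derivative (legendrePoly m n)).eval u * log u +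
        (legendrePoly m n).eval u * u⁻¹ +
        (digamma ((n : ℂ) + m + 1) - digamma ((n : ℂ) - m + 1)) *
          (derivative (legendrePoly m n)).eval u +
        (derivative (legendreDigammaPoly m n)).eval u -
        (u * (derivative (legendreTailPoly m n)).eval u - m * (legendreTailPoly m n).eval u) /
          u ^ (m + 1))) u := by
  have hu0 := slitPlane_ne_zero hu
  have h1 := ((legendrePoly m n).hasDerivAt u).mul (hasDerivAt_log hu)
  have h2 := ((legendrePoly m n).hasDerivAt u).const_mul
    (digamma ((n : ℂ) + m + 1) - digamma ((n : ℂ) - m + 1))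
  have h3 := (legendreDigammaPoly m n).hasDerivAt u
  have h4 := ((legendreTailPoly m n).hasDerivAt u).div (hasDerivAt_pow m u) (pow_ne_zero m hu0)
  convert! (((h1.add h2).add h3).sub h4).const_mul (legendreScale m n) using 2
  congr 1
  rw [div_eq_div_iff (pow_ne_zero _ hu0) (pow_ne_zero _ (pow_ne_zero _ hu0))]
  rcases m with _ | m
  · simp
    ring
  · simp only [Nat.add_sub_cancel]
    ring

/-- Separates into the log u part, the polynomial part and the polar part, one for each polynomial
recurrence. -/
theorem legendreDegreeDeriv_order_succ {m n : ℕ} (hmn : m < n) {u : ℂ} (hu : u ∈ slitPlane) :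
    (u - 1) * deriv (legendreDegreeDeriv m n) u - m * legendreDegreeDeriv m n u =
      legendreDegreeDeriv (m + 1) n u := by
  have hu0 := slitPlane_ne_zero hu
  have hum := pow_ne_zero m hu0
  have e1 := congrArg (eval u) (legendrePoly_order_succ m n)
  have e2 := congrArg (eval u) (legendreDigammaPoly_order_succ m n)
  have e3 := congrArg (eval u) (legendreTailPoly_order_succ hmn)
  have e4 := congrArg (eval u) (divX_mul_X_add (legendrePoly m n))
  rw [coeff_legendrePoly] at e4
  simp only [eval_add, eval_sub, eval_mul, eval_X, eval_one, eval_C, eval_pow] at e1 e2 e3 e4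
  have d1 := digamma_natCast_succ (n + m)
  -- Gives ψ(n - m + 1) = ψ(n - m) + 1/(n - m); m < n makes the truncated subtraction genuine.
  have d2 := digamma_natCast_succ (n - m - 1)
  have c : ((n - m - 1 : ℕ) : ℂ) = n - m - 1 := by
    rw [Nat.sub_sub, Nat.cast_sub (by lia)]; push_cast; ring
  rw [c] at d2
  push_cast at d1
  have n1 : (n : ℂ) + m + 1 ≠ 0 := by exact_mod_cast Nat.succ_ne_zero (n + m)
  have n2 : (n : ℂ) - m ≠ 0 := by
    rw [← Nat.cast_sub hmn.le]; exact_mod_cast (Nat.sub_pos_of_lt hmn).ne'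
  rw [(hasDerivAt_legendreDegreeDeriv m n hu).deriv]
  simp only [legendreDegreeDeriv]
  rw [legendreScale_order_succ hmn]
  push_cast
  rw [show (n : ℂ) + (m + 1) + 1 = n + m + 1 + 1 by ring, d1,
    show (n : ℂ) - m + 1 = n - m - 1 + 1 + 1 by ring, d2,
    show (n : ℂ) - (m + 1) + 1 = n - m - 1 + 1 by ring,
    show (n : ℂ) - m - 1 + 1 = n - m by ring]
  have hσ : ((n : ℂ) - m) * (n + m + 1) * (1 / ((n : ℂ) + m + 1) + 1 / (n - m)) = 2 * n + 1 := by
    field_simp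
    ring
  have hP : (legendrePoly m n).eval u * u⁻¹ =
      (divX (legendrePoly m n)).eval u + legendreCoeff m n 0 * u⁻¹ := by
    rw [← e4]
    field_simp
  have hT : ((u - 1) * (u * (derivative (legendreTailPoly m n)).eval u -
      m * (legendreTailPoly m n).eval u)) / u ^ (m + 1) - m * ((legendreTailPoly m n).eval u / u ^ m) +
      legendreCoeff m n 0 * u⁻¹ =
      ((n : ℂ) - m) * (n + m + 1) * (legendreTailPoly (m + 1) n).eval u / u ^ (m + 1) := by
    rw [← e3, pow_succ]
    field_simp
  have hPP : (u - 1) * ((legendrePoly m n).eval u * u⁻¹) = (legendrePoly m n).eval u -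
      (legendrePoly m n).eval u * u⁻¹ := by
    field_simp
  rw [mul_assoc, ← sub_eq_zero]
  set A := (legendrePoly m n).eval u
  set A' := (legendrePoly (m + 1) n).eval u
  set B := digamma ((n : ℂ) + m + 1)
  set B' := digamma ((n : ℂ) - m)
  generalize 1 / ((n : ℂ) + m + 1) = i1 at hσ ⊢
  generalize 1 / ((n : ℂ) - m) = i2 at hσ ⊢
  linear_combination legendreScale m n * ((log u + (B - (B' + i2))) * e1 + e2 - hT + hPP - hP -
    A' * hσ)

/-- The series terminates to the shifted Legendre polynomial, whose symmetry under w ↦ 1 - w, with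
sign (-1)^n, re-expands it in powers of u. -/
theorem hypergeometricReg_one_eq_legendrePoly (n : ℕ)
    (h : IsHypergeometricContinuation (-n) (n + 1) 1 (hypergeometricReg (-n) (n + 1) 1)) :
    Set.EqOn (hypergeometricReg (-n) (n + 1) 1)
      (fun w => legendreScale 0 n * (legendrePoly 0 n).eval (1 - w)) hypergeometricDomain := by
  have hd : Differentiable ℂ fun w : ℂ => (legendrePoly 0 n).eval (1 - w) :=
    (legendrePoly 0 n).differentiable.comp (by fun_prop : Differentiable ℂ fun w : ℂ => 1 - w)
  refine eqOn_hypergeometricDomain_of_eqOn_ball h.1 (hd.const_mul _).differentiableOn fun w hw => ?_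
  refine (h.hasTaylorCoeffs w hw).unique ?_
  have hcoeff : ∀ k, (ascPochhammer ℂ k).eval (-(n : ℂ)) * (ascPochhammer ℂ k).eval ((n : ℂ) + 1) /
      (k.factorial * Gamma (1 + k)) = (-1) ^ k * n.choose k * (n + k).choose n := by
    intro k
    have f1 : (k.factorial : ℂ) ≠ 0 := by exact_mod_cast k.factorial_ne_zero
    have f2 : (n.factorial : ℂ) ≠ 0 := by exact_mod_cast n.factorial_ne_zero
    have h1 := eval_ascPochhammer_comp_X_add_one k n
    rw [eval_comp, eval_add, eval_X, eval_one] at h1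
    have h2 : ((n + k).choose n : ℂ) * n.factorial * k.factorial = (n + k).factorial := by
      have := Nat.choose_mul_factorial_mul_factorial (Nat.le_add_right n k)
      rw [Nat.add_sub_cancel_left] at this
      exact_mod_cast this
    have h3 : (n.descFactorial k : ℂ) = k.factorial * n.choose k := by
      exact_mod_cast Nat.descFactorial_eq_factorial_mul_choose n k
    rw [ascPochhammer_eval_neg_eq_descPochhammer, descPochhammer_eval_eq_descFactorial, h3,
      add_comm (1 : ℂ), Gamma_nat_eq_factorial, div_eq_iff (mul_ne_zero f1 f1)]
    refine mul_right_cancel₀ f2 ?_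
    linear_combination (-1) ^ k * k.factorial * n.choose k * (h1 - h2)
  simp only [hcoeff]
  have hsum : HasSum (fun k => (-1) ^ k * n.choose k * (n + k).choose n * w ^ k)
      (∑ k ∈ Finset.range (n + 1), (-1) ^ k * n.choose k * (n + k).choose n * w ^ k) :=
    hasSum_sum_of_ne_finset_zero fun k hk => by
      rw [Nat.choose_eq_zero_of_lt (by simpa using hk)]
      simp
  convert! hsum using 1
  have hev : ∀ v : ℂ, aeval v (shiftedLegendre n) =
      ∑ k ∈ Finset.range (n + 1), (-1) ^ k * n.choose k * (n + k).choose n * v ^ k := fun v => by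
    simp [shiftedLegendre]
  rw [← hev, shiftedLegendre_eval_symm, hev, legendrePoly, eval_rangePoly, legendreScale]
  have f2 : (n.factorial : ℂ) ≠ 0 := by exact_mod_cast n.factorial_ne_zero
  rw [Nat.sub_zero, add_zero, div_self f2, mul_one]
  congr 1
  refine Finset.sum_congr rfl fun k _ => ?_
  have f1 : (k.factorial : ℂ) ≠ 0 := by exact_mod_cast k.factorial_ne_zero
  have h2 : ((n + k).choose n : ℂ) * n.factorial * k.factorial = (k + n).factorial := by
    have := Nat.choose_mul_factorial_mul_factorial (Nat.le_add_right n k)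
    rw [Nat.add_sub_cancel_left, add_comm] at this
    rw [add_comm n k]
    exact_mod_cast this
  rw [legendreCoeff, ← h2, add_zero]
  field_simp

end OrderRecurrence

/-! ### Identification of the degree derivative and the final formula -/

section Main

open Complex Filter Topology Metric Polynomial

theorem deriv_legendre_operator_comp_one_sub (f : ℂ → ℂ) (w : ℂ) :
    deriv (fun v => v * (1 - v) * deriv (fun w => f (1 - w)) v) w =
      deriv (fun u => u * (1 - u) * deriv f u) (1 - w) := by
  set g : ℂ → ℂ := fun u => u * (1 - u) * deriv f u with hg
  have e : (fun v => v * (1 - v) * deriv (fun w => f (1 - w)) v) = fun v => -g (1 - v) := by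
    funext v
    rw [deriv_comp_const_sub, hg]
    ring
  rw [e, deriv.fun_neg, deriv_comp_const_sub, neg_neg]

theorem legendre_equation_legendreDegreeDeriv (n : ℕ) {u : ℂ} (hu : u ∈ slitPlane) :
    deriv (fun u => u * (1 - u) * deriv (legendreDegreeDeriv 0 n) u) u +
      n * (n + 1) * legendreDegreeDeriv 0 n u =
      -(2 * n + 1) * (legendreScale 0 n * (legendrePoly 0 n).eval u) := by
  have hu0 := slitPlane_ne_zero hu
  set c := digamma ((n : ℂ) + (0 : ℕ) + 1) - digamma ((n : ℂ) - (0 : ℕ) + 1) with hc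
  set A := X * (1 - X) * derivative (legendrePoly 0 n) with hA
  set B := X * (1 - X) * derivative (legendreDigammaPoly 0 n) with hB
  have htail : legendreTailPoly 0 n = 0 := by simp [legendreTailPoly, rangePoly]
  have heq : (fun u => u * (1 - u) * deriv (legendreDegreeDeriv 0 n) u) =ᶠ[𝓝 u]
      fun u => legendreScale 0 n * (A.eval u * log u + ((1 - X) * legendrePoly 0 n).eval u +
        c * A.eval u + B.eval u) := by
    filter_upwards [isOpen_slitPlane.mem_nhds hu] with v hv
    have hv0 := slitPlane_ne_zero hv
    rw [(hasDerivAt_legendreDegreeDeriv 0 n hv).deriv, htail, ← hc, hA, hB]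
    simp only [eval_mul, eval_sub, eval_X, eval_one, derivative_zero, eval_zero, mul_zero, sub_zero,
      zero_div]
    field_simp
  have hd := (((((A.hasDerivAt u).mul (hasDerivAt_log hu)).add
    (((1 - X) * legendrePoly 0 n).hasDerivAt u)).add ((A.hasDerivAt u).const_mul c)).add
    (B.hasDerivAt u)).const_mul (legendreScale 0 n)
  have e1 := congrArg (eval u) (legendre_equation_legendrePoly n)
  have e2 := congrArg (eval u) (legendre_equation_legendreDigammaPoly n)
  rw [← hA] at e1
  rw [← hB] at e2
  have hlog : A.eval u * u⁻¹ = (1 - u) * (derivative (legendrePoly 0 n)).eval u := by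
    rw [hA]
    simp only [eval_mul, eval_sub, eval_X, eval_one]
    field_simp
  have hd' := heq.deriv_eq.trans (HasDerivAt.deriv hd)
  rw [hd', hlog, legendreDegreeDeriv, htail, ← hc]
  simp only [derivative_mul, derivative_sub, derivative_X, derivative_one, eval_mul, eval_add,
    eval_sub, eval_neg, eval_X, eval_one, eval_C, eval_zero, zero_div, eval_ofNat] at e1 e2 ⊢
  linear_combination legendreScale 0 n * ((log u + c) * e1 + e2)

theorem differentiableOn_legendreDegreeDeriv_one_sub (m n : ℕ) :
    DifferentiableOn ℂ (fun w => legendreDegreeDeriv m n (1 - w)) hypergeometricDomain :=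
  fun w hw => ((hasDerivAt_legendreDegreeDeriv m n
    (show 1 - w ∈ slitPlane from hw)).differentiableAt.comp w (by fun_prop)).differentiableWithinAt

/-- The difference from the abstract derivative solves the homogeneous equation and vanishes at w =
0, where log u and the digamma sum both vanish. -/
theorem hasHypergeometricDegreeDeriv_one (n : ℕ) :
    HasHypergeometricDegreeDeriv n 1 (fun w => legendreDegreeDeriv 0 n (1 - w)) := by
  obtain ⟨H, hH⟩ := exists_hasHypergeometricDegreeDeriv_one n
  have hR := differentiableOn_legendreDegreeDeriv_one_sub 0 n
  have hF := hypergeometricReg_one_eq_legendrePoly n hH.continuation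
  refine hH.congr fun w hw => sub_eq_zero.1 ?_
  refine eqOn_zero_of_legendre_equation (l := n * (n + 1))
    (D := fun w => H w - legendreDegreeDeriv 0 n (1 - w)) (hH.differentiableOn.sub hR) ?_ ?_ hw
  · simp [hH.apply_zero, legendreDegreeDeriv, eval_one_legendreDigammaPoly, legendreTailPoly,
      rangePoly]
  · intro w hw
    have hwU := ball_subset_hypergeometricDomain hw
    have hdiff : ∀ {f : ℂ → ℂ}, DifferentiableOn ℂ f hypergeometricDomain →
        DifferentiableAt ℂ (fun v => v * (1 - v) * deriv f v) w := fun hf =>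
      (show DifferentiableAt ℂ (fun v : ℂ => v * (1 - v)) w by fun_prop).mul
        ((hf.deriv isOpen_hypergeometricDomain).differentiableAt
          (isOpen_hypergeometricDomain.mem_nhds hwU))
    have heq : (fun v => v * (1 - v) * deriv (fun w => H w - legendreDegreeDeriv 0 n (1 - w)) v)
        =ᶠ[𝓝 w] fun v => v * (1 - v) * deriv H v -
          v * (1 - v) * deriv (fun w => legendreDegreeDeriv 0 n (1 - w)) v := by
      filter_upwards [isOpen_hypergeometricDomain.mem_nhds hwU] with v hv
      have hn := isOpen_hypergeometricDomain.mem_nhds hv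
      rw [deriv_fun_sub (hH.differentiableOn.differentiableAt hn) (hR.differentiableAt hn)]
      ring
    rw [heq.deriv_eq, deriv_fun_sub (hdiff hH.differentiableOn) (hdiff hR),
      deriv_legendre_operator_comp_one_sub]
    have h1 := hH.legendre_equation hw
    have h2 := legendre_equation_legendreDegreeDeriv n (show 1 - w ∈ slitPlane from hwU)
    rw [hF hwU] at h1
    linear_combination h1 - h2

theorem hasHypergeometricDegreeDeriv_one_sub {m n : ℕ} (hmn : m ≤ n) :
    HasHypergeometricDegreeDeriv n (1 - m) (fun w => legendreDegreeDeriv m n (1 - w)) ∧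
      Set.EqOn (hypergeometricReg (-n) (n + 1) (1 - m))
        (fun w => legendreScale m n * (legendrePoly m n).eval (1 - w)) hypergeometricDomain := by
  induction m with
  | zero =>
    have h := hasHypergeometricDegreeDeriv_one n
    simp only [Nat.cast_zero, sub_zero]
    exact ⟨h, hypergeometricReg_one_eq_legendrePoly n h.continuation⟩
  | succ m ih =>
    obtain ⟨h, hF⟩ := ih (Nat.le_of_succ_le hmn)
    have e : (1 : ℂ) - m = 1 - (m + 1 : ℕ) + 1 := by push_cast; ring
    have hc : (1 : ℂ) - (m + 1 : ℕ) = -m := by push_cast; ring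
    rw [e] at h hF
    refine ⟨h.lower.congr fun w hw => ?_, fun w hw => ?_⟩
    · have := legendreDegreeDeriv_order_succ hmn (show 1 - w ∈ slitPlane from hw)
      simp only [deriv_comp_const_sub, hc, ← this]
      ring
    · have hev : (fun v => hypergeometricReg (-n) (n + 1) (1 - (m + 1 : ℕ) + 1) v) =ᶠ[𝓝 w]
          fun v => legendreScale m n * (legendrePoly m n).eval (1 - v) :=
        hF.eventuallyEq_of_mem (isOpen_hypergeometricDomain.mem_nhds hw)
      have e1 := congrArg (eval (1 - w)) (legendrePoly_order_succ m n)
      simp only [eval_sub, eval_mul, eval_X, eval_one, eval_C] at e1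
      have hd := (((legendrePoly m n).hasDerivAt (1 - w)).comp_const_sub 1 w).const_mul
        (legendreScale m n)
      have hd' := hev.deriv_eq.trans hd.deriv
      rw [h.hypergeometricReg_lower hw, hd', hF hw, hc]
      simp only [legendreScale_order_succ hmn]
      linear_combination legendreScale m n * e1

/-- Division by the positive real 2 only shifts the principal logarithm by a real constant, so no
branch correction appears. -/
theorem cpow_mul_cpow_neg_half {z : ℂ} (hz : z - 1 ∈ slitPlane) (m : ℕ) :
    ((z - 1) / 2) ^ (-(m : ℂ) / 2) * ((z + 1) / 2) ^ (-(m : ℂ) / 2) =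
      (z + 1) ^ ((m : ℂ) / 2) * (z - 1) ^ (-(m : ℂ) / 2) * (((z + 1) / 2) ^ m)⁻¹ := by
  have h1 : z - 1 ≠ 0 := slitPlane_ne_zero hz
  have h2 : z + 1 ≠ 0 := by
    intro h
    rw [show z - 1 = -2 by linear_combination h, mem_slitPlane_iff] at hz
    norm_num at hz
  have hlog : ∀ x : ℂ, x ≠ 0 → log (x / 2) = log x + Real.log 2⁻¹ := fun x hx => by
    rw [show x / 2 = ((2⁻¹ : ℝ) : ℂ) * x by push_cast; ring, log_ofReal_mul (by norm_num) hx,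
      add_comm]
  have hpow : ((z + 1) / 2) ^ m = exp (m * (log (z + 1) + Real.log 2⁻¹)) := by
    rw [← hlog _ h2, exp_nat_mul, exp_log (div_ne_zero h2 two_ne_zero)]
  rw [hpow, cpow_def_of_ne_zero (div_ne_zero h1 two_ne_zero),
    cpow_def_of_ne_zero (div_ne_zero h2 two_ne_zero), cpow_def_of_ne_zero h1,
    cpow_def_of_ne_zero h2, hlog _ h1, hlog _ h2, ← exp_neg, ← exp_add, ← exp_add, ← exp_add]
  congr 1
  ring

open Complex Nat in
theorem mainTheorem2 (m n : ℕ) (hmn : m ≤ n) (z : ℂ) (hz : z - 1 ∈ Complex.slitPlane) :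
    HasDerivAt (fun ν : ℂ => legendreP ν (m : ℂ) z)
      (legendreP n m z * Complex.log ((z + 1) / 2)
        + (digamma ((n : ℂ) + m + 1) - digamma ((n : ℂ) - m + 1)) * legendreP n m z
        - (-1 : ℂ) ^ n * ((n + m)! / (n - m)! : ℂ)
            * (((z - 1) / 2) ^ (-(m : ℂ) / 2) * ((z + 1) / 2) ^ (-(m : ℂ) / 2))
            * ∑ k ∈ Finset.range m,
                (((k + n - m)! : ℕ) * ((m - k - 1)! : ℕ) : ℂ) / ((k ! : ℕ) * ((n + m - k)! : ℕ))
                  * ((z + 1) / 2) ^ k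
        + (-1 : ℂ) ^ n * (((n + m)! : ℕ) / ((n - m)! : ℕ) : ℂ)
            * ((z + 1) ^ ((m : ℂ) / 2) * (z - 1) ^ (-(m : ℂ) / 2))
            * ∑ k ∈ Finset.range (n + 1),
                (-1 : ℂ) ^ k * ((k + n)! : ℕ) / ((k ! : ℕ) * ((k + m)! : ℕ) * ((n - k)! : ℕ))
                  * (2 * digamma ((k : ℂ) + n + 1) - digamma ((k : ℂ) + m + 1)
                      - digamma ((k : ℂ) + 1))
                  * ((z + 1) / 2) ^ k)
      (n : ℂ) := by
  set w : ℂ := (1 - z) / 2 with hw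
  set u : ℂ := (z + 1) / 2 with hu
  have hwu : 1 - w = u := by rw [hw, hu]; ring
  have hus : u ∈ slitPlane := by
    -- Writing u = (z - 1)/2 + 1 shows that u avoids the cut whenever z - 1 does.
    have : u = ((1 / 2 : ℝ) : ℂ) * (z - 1) + (1 : ℝ) := by rw [hu]; push_cast; ring
    rw [mem_slitPlane_iff] at hz ⊢
    rw [this, add_re, add_im, re_ofReal_mul, im_ofReal_mul, ofReal_re, ofReal_im]
    rcases hz with h | h
    · exact Or.inl (by linarith)
    · exact Or.inr (by simpa using h)
  have hwU : w ∈ hypergeometricDomain := show 1 - w ∈ slitPlane from hwu ▸ hus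
  have hu0 := slitPlane_ne_zero hus
  obtain ⟨h, hF⟩ := hasHypergeometricDegreeDeriv_one_sub hmn
  have hd := (h.hasDerivAt hwU).const_mul ((z + 1) ^ ((m : ℂ) / 2) * (z - 1) ^ (-(m : ℂ) / 2))
  have hP := hF hwU
  have hD : ∑ k ∈ Finset.range (n + 1),
      (-1 : ℂ) ^ k * ((k + n)! : ℕ) / ((k ! : ℕ) * ((k + m)! : ℕ) * ((n - k)! : ℕ))
        * (2 * digamma ((k : ℂ) + n + 1) - digamma ((k : ℂ) + m + 1) - digamma ((k : ℂ) + 1))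
        * u ^ k = (legendreDigammaPoly m n).eval u := by
    rw [legendreDigammaPoly, eval_rangePoly]
    refine Finset.sum_congr rfl fun k hk => ?_
    rw [legendreCoeff_of_le (Nat.lt_succ_iff.1 (Finset.mem_range.1 hk)), legendreDigamma]
  have hT : ∑ k ∈ Finset.range m,
      (((k + n - m)! : ℕ) * ((m - k - 1)! : ℕ) : ℂ) / ((k ! : ℕ) * ((n + m - k)! : ℕ)) * u ^ k =
      (legendreTailPoly m n).eval u := by
    rw [legendreTailPoly, eval_rangePoly]
    rfl
  rw [hD, hT, cpow_mul_cpow_neg_half hz]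
  simp only [legendreP] at hd ⊢
  convert! hd using 1
  simp only at hP
  rw [← hw, hP, hwu, legendreDegreeDeriv, legendreScale]
  ring

end Main
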